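/- Theorem 1.3. For every positive integer $n \equiv 0 \pmod 8$, the complete graph $K_n$ has a quadrangular embedding in an orientable surface. Here a surface is a compact Hausdorff $2$-manifold without boundary; an embedding of a graph in a surface draws its vertices as distinct points and its edges as simple arcs joining their ends, arcs meeting only at common ends; the faces are the connected components of the complement of the drawing; and an embedding is quadrangular if every face is homeomorphic to an open disc and is bounded by a $4$-cycle of the graph. -/

import Mathlib

/-- A surface: a compact Hausdorff space in which every point has an open neighbourhood
homeomorphic to an open subset of the Euclidean plane (a compact `2`-manifold without boundary).
The plane is taken to be `ℂ`. Connectedness is not required. -/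
structure IsSurface (S : Type*) [TopologicalSpace S] : Prop where
  compact : CompactSpace S
  t2 : T2Space S
  locally_planar : ∀ x : S, ∃ e : OpenPartialHomeomorph S ℂ, x ∈ e.source

/-- A homeomorphism `f` between open subsets of the plane preserves the orientation: around every
point `z` of its domain there is a closed disc in the domain such that, as a point runs once
counterclockwise around the bounding circle, its image winds exactly once counterclockwise
around `f z`. Here `θ` is a continuous determination of the argument of the image. -/
def PreservesOrientation (f : OpenPartialHomeomorph ℂ ℂ) : Prop :=
  ∀ z ∈ f.source, ∃ r : ℝ, 0 < r ∧ Metric.closedBall z r ⊆ f.source ∧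
    ∃ θ : ℝ → ℝ, Continuous θ ∧
      (∀ t : ℝ, f (circleMap z r t) - f z =
        (‖f (circleMap z r t) - f z‖ : ℂ) * Complex.exp (θ t * Complex.I)) ∧
      θ (2 * Real.pi) = θ 0 + 2 * Real.pi

/-- A surface is orientable if it has an atlas all of whose coordinate changes preserve the
orientation of the plane. (For a disconnected surface this says that every component is
orientable.) -/
def IsOrientableSurface (S : Type*) [TopologicalSpace S] : Prop :=
  IsSurface S ∧ ∃ A : Set (OpenPartialHomeomorph S ℂ),
    (∀ x : S, ∃ e ∈ A, x ∈ e.source) ∧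
    ∀ e ∈ A, ∀ e' ∈ A, PreservesOrientation (e.symm.trans e')

/-- A drawing of a simple graph in a space without crossings: the vertices are distinct points and
the edges are simple arcs which join their ends and meet only at common ends. A dart is an edge
with a direction; its two directions give the same arc, run through in opposite directions. -/
structure GraphEmbedding {V : Type*} (G : SimpleGraph V) (S : Type*) [TopologicalSpace S] where
  vert : V → S
  vert_injective : Function.Injective vert
  arc : ∀ d : G.Dart, Path (vert d.fst) (vert d.snd)
  arc_symm : ∀ d : G.Dart, arc d.symm = (arc d).symm
  arc_injective : ∀ d : G.Dart, Function.Injective (arc d)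
  /-- no arc has a vertex in its interior -/
  arc_eq_vert : ∀ (d : G.Dart) (t : unitInterval) (v : V), arc d t = vert v → t = 0 ∨ t = 1
  /-- the interior of an arc does not meet the arc of another edge -/
  arc_eq_arc : ∀ (d d' : G.Dart) (t t' : unitInterval),
    arc d t = arc d' t' → d.edge = d'.edge ∨ t = 0 ∨ t = 1

namespace GraphEmbedding

variable {V : Type*} {G : SimpleGraph V} {S : Type*} [TopologicalSpace S]

/-- The set of points of the drawing. -/
def support (Φ : GraphEmbedding G S) : Set S :=
  Set.range Φ.vert ∪ ⋃ d : G.Dart, Set.range (Φ.arc d)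

/-- The faces are the connected components of the complement of the drawing. -/
def IsFace (Φ : GraphEmbedding G S) (F : Set S) : Prop :=
  ∃ x ∈ Φ.supportᶜ, F = connectedComponentIn Φ.supportᶜ x

/-- Every face is homeomorphic to an open disc. -/
def IsCellular (Φ : GraphEmbedding G S) : Prop :=
  ∀ F : Set S, Φ.IsFace F → Nonempty (F ≃ₜ Metric.ball (0 : ℂ) 1)

/-- The set `F` is bounded by the closed walk `w`, a cycle: some embedding of the closed unit disc
maps the open disc onto `F` and the unit circle onto the cycle. -/
def IsBoundedBy (Φ : GraphEmbedding G S) (F : Set S) {v : V} (w : G.Walk v v) : Prop :=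
  w.IsCycle ∧ ∃ φ : ℂ → S, ContinuousOn φ (Metric.closedBall 0 1) ∧
    Set.InjOn φ (Metric.closedBall 0 1) ∧
    φ '' Metric.ball 0 1 = F ∧
    φ '' Metric.sphere 0 1 = ⋃ d ∈ w.darts, Set.range (Φ.arc d)

/-- A quadrangular embedding: a cellular embedding in which every face is bounded by a
`4`-cycle. -/
def IsQuadrangular (Φ : GraphEmbedding G S) : Prop :=
  Φ.IsCellular ∧ ∀ F : Set S, Φ.IsFace F →
    ∃ (v : V) (w : G.Walk v v), w.length = 4 ∧ Φ.IsBoundedBy F w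

end GraphEmbedding

/-! An embedding of a complete graph in an orientable surface is encoded by a rotation system, a
cyclic order `σ v` of the other vertices at each vertex `v`. That all faces are quadrangles is a
condition on `σ` alone (`IsQuadRotation`). The proof constructs such a `σ` on `8k` vertices and
realises every such `σ` by an explicit surface.

Combinatorics. The vertices form `k` blocks of eight, each made of four pairs of twins `(c, false)`,
`(c, true)`. Each block carries a copy of a quadrangular embedding of `K₈` in which every pair of
twins forms opposite corners of a distinguished face. At both twins the cyclic order is cut open at
that face, and the twin pairs of all other blocks are inserted in the gap, in opposite orders at the
two twins. If `p`, `q` are consecutive across a gap between inserted pairs, then `(c, true), p, (c,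
false), q` is a face: at the twins of `c` because their orders are opposite, at `p` and `q` because
the twins of `c` are consecutive there in the required direction (`isQuadFace_seam`). Thus each
distinguished face is replaced by quadrangles that reach the other blocks. Together with the other
faces of the copies of `K₈` they contain every dart (`isQuadRotation_blockRotation`).

Topology. Unit squares, one for each face, are glued inside a Euclidean space (`quadSurface`):
bilinear barycentric coordinates glue the sides, and bump coordinates keep the interiors of
different squares apart. With `m` neighbours at a vertex, `m` quarter discs meet there in cyclic
order, and branches of `z ^ (4 / m)` spread them over the sectors of the unit disc (`exists_chart`).
Two different charts overlap only away from the vertices, so their transition has nonzero complex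
derivatives and preserves orientation (`isOrientableSurface_quadSurface`). The faces of the drawing
are the open squares, and their four corners are distinct (`isQuadrangular_quadEmbedding`). -/

section

open Set Topology

/-! ### Orientation, gluing and conformality: general lemmas -/

/-- A homeomorphism between plane domains with nonzero complex derivatives preserves orientation. -/
theorem preservesOrientation_of_hasDerivAt {f : OpenPartialHomeomorph ℂ ℂ}
    (hf : ∀ z ∈ f.source, ∃ a : ℂ, a ≠ 0 ∧ HasDerivAt f a z) : PreservesOrientation f := by
  intro z hz
  obtain ⟨a, ha, hd⟩ := hf z hz
  -- An error of at most half the linear term keeps the quotient `q` below within `1 / 2` of `1`,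
  -- hence in the right half-plane. There its argument is continuous and returns to its initial
  -- value, so the whole winding comes from the circle itself.
  have h1 := hd.isLittleO.def (c := ‖a‖ / 2) (by positivity)
  obtain ⟨r₁, hr₁, h1⟩ := Metric.eventually_nhds_iff_ball.1 h1
  obtain ⟨r₂, hr₂, h2⟩ := Metric.isOpen_iff.1 f.open_source z hz
  obtain ⟨r, hr, hrr⟩ := exists_between (lt_min hr₁ hr₂)
  have hsub : Metric.closedBall z r ⊆ f.source :=
    (Metric.closedBall_subset_ball (hrr.trans_le (min_le_right _ _))).trans h2
  have hmem : ∀ t, circleMap z r t ∈ Metric.closedBall z r := fun t =>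
    circleMap_mem_closedBall _ hr.le _
  set q : ℝ → ℂ := fun t => (f (circleMap z r t) - f z) / (a * (circleMap z r t - z)) with hq
  have hne : ∀ t, circleMap z r t - z ≠ 0 := fun t => by
    rw [sub_ne_zero]; exact circleMap_ne_center hr.ne'
  have hqc : Continuous q := by
    refine Continuous.div (Continuous.sub ?_ continuous_const) (by fun_prop)
      (fun t => mul_ne_zero ha (hne t))
    exact (f.continuousOn.mono hsub).comp_continuous (continuous_circleMap z r) hmem
  have hq1 : ∀ t, ‖q t - 1‖ ≤ 1 / 2 := by
    intro t
    have hb := h1 (circleMap z r t)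
      (Metric.closedBall_subset_ball (hrr.trans_le (min_le_left _ _)) (hmem t))
    have e : q t - 1 = (f (circleMap z r t) - f z - (circleMap z r t - z) • a)
        / (a * (circleMap z r t - z)) := by
      have := hne t
      simp only [hq, smul_eq_mul]
      field_simp
    rw [e, norm_div, norm_mul, div_le_iff₀ (mul_pos (norm_pos_iff.2 ha) (norm_pos_iff.2 (hne t)))]
    simpa [mul_assoc, div_eq_mul_inv, mul_comm, mul_left_comm] using hb
  have hre : ∀ t, 0 < (q t).re := by
    intro t
    have := (Complex.abs_re_le_norm (q t - 1)).trans (hq1 t)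
    rw [abs_le] at this
    simp at this
    linarith [this.1]
  refine ⟨r, hr, hsub, fun t => t + a.arg + (q t).arg, ?_, ?_, ?_⟩
  · have : Continuous fun t => (q t).arg := continuous_iff_continuousAt.2 fun t =>
      (Complex.continuousAt_arg (Or.inl (hre t))).comp hqc.continuousAt
    fun_prop
  · intro t
    have e : f (circleMap z r t) - f z = (r * Complex.exp (t * Complex.I)) * a * q t := by
      have h0 := hne t
      have : circleMap z r t - z = r * Complex.exp (t * Complex.I) := by simp [circleMap]
      rw [← this]; simp only [hq]; field_simp
    have hn : ‖f (circleMap z r t) - f z‖ = r * ‖a‖ * ‖q t‖ := by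
      rw [e]; simp [abs_of_pos hr, Complex.norm_exp_ofReal_mul_I]
    rw [hn, e]
    conv_lhs => rw [← Complex.norm_mul_exp_arg_mul_I a, ← Complex.norm_mul_exp_arg_mul_I (q t)]
    push_cast
    rw [add_mul, add_mul, Complex.exp_add, Complex.exp_add]
    ring
  · have : q (2 * Real.pi) = q 0 := by
      have h := periodic_circleMap z r 0
      simp only [zero_add] at h
      simp only [hq, h]
    simp only [this]; ring

/-- A continuous map on a compact space which is constant on the fibres of another one factors
through the image of the latter. -/
theorem continuousOn_comp_invFun {K X Y : Type*} [TopologicalSpace K]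
    [CompactSpace K] [TopologicalSpace X] [TopologicalSpace Y] [T2Space Y] [Nonempty K]
    {a : K → X} {b : K → Y} (ha : Continuous a) (hb : Continuous b)
    (hab : ∀ k l, b k = b l → a k = a l) :
    ContinuousOn (a ∘ Function.invFun b) (range b) := by
  rw [continuousOn_iff_isClosed]
  intro C hC
  -- Compactness makes `b` a closed map, so the preimage of `C` under the factored map is cut out by
  -- a closed set.
  refine ⟨b '' (a ⁻¹' C), ((hC.preimage ha).isCompact.image hb).isClosed, ?_⟩
  ext y
  constructor
  · rintro ⟨hy, k, rfl⟩
    refine ⟨⟨_, hy, Function.invFun_eq ⟨k, rfl⟩⟩, k, rfl⟩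
  · rintro ⟨⟨k, hk, rfl⟩, hy⟩
    refine ⟨?_, hy⟩
    have := hab _ _ (Function.invFun_eq (f := b) ⟨k, rfl⟩)
    simpa [this] using hk

/-- Two maps with the same fibres from a compact space to Hausdorff spaces induce a
homeomorphism between open parts of their images. -/
theorem exists_openPartialHomeomorph_of_same_fibres {K X Y : Type*} [TopologicalSpace K]
    [CompactSpace K] [TopologicalSpace X] [T2Space X] [TopologicalSpace Y] [T2Space Y]
    [Nonempty K]
    {a : K → X} {b : K → Y} (ha : Continuous a) (hb : Continuous b)
    (hab : ∀ k l, a k = a l ↔ b k = b l) {O : Set Y} (hO : IsOpen O) (hOb : O ⊆ range b)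
    (hOa : a '' (b ⁻¹' O) ⊆ interior (range a)) :
    ∃ e : OpenPartialHomeomorph Y X, e.source = O ∧ e.target = a '' (b ⁻¹' O) ∧
      ∀ k, b k ∈ O → e (b k) = a k := by
  have hf := continuousOn_comp_invFun ha hb fun k l => (hab k l).2
  have hg := continuousOn_comp_invFun hb ha fun k l => (hab k l).1
  have hfb : ∀ k, (a ∘ Function.invFun b) (b k) = a k := fun k =>
    (hab _ _).2 (Function.invFun_eq (f := b) ⟨k, rfl⟩)
  have hga : ∀ k, (b ∘ Function.invFun a) (a k) = b k := fun k =>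
    (hab _ _).1 (Function.invFun_eq (f := a) ⟨k, rfl⟩)
  -- This exhibits the target as a preimage of `O` under the continuous inverse within an open set,
  -- which gives its openness.
  have hT : a '' (b ⁻¹' O) = interior (range a) ∩ (b ∘ Function.invFun a) ⁻¹' O := by
    ext x
    constructor
    · rintro ⟨k, hk, rfl⟩
      refine ⟨hOa ⟨k, hk, rfl⟩, ?_⟩
      rw [mem_preimage, hga]; exact hk
    · rintro ⟨hx, hx'⟩
      obtain ⟨k, rfl⟩ := interior_subset hx
      rw [mem_preimage, hga] at hx'
      exact ⟨k, hx', rfl⟩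
  refine ⟨⟨⟨⟨a ∘ Function.invFun b, b ∘ Function.invFun a, O, a '' (b ⁻¹' O), ?_, ?_, ?_, ?_⟩,
    hf.mono hOb, hg.mono (image_subset_range _ _)⟩, hO, ?_⟩, rfl, rfl, fun k _ => hfb k⟩
  · intro y hy
    obtain ⟨k, rfl⟩ := hOb hy
    rw [hfb]; exact ⟨k, hy, rfl⟩
  · rintro _ ⟨k, hk, rfl⟩
    rw [hga]; exact hk
  · intro y hy
    obtain ⟨k, rfl⟩ := hOb hy
    rw [hfb, hga]
  · rintro _ ⟨k, hk, rfl⟩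
    rw [hga, hfb]
  · change IsOpen (a '' (b ⁻¹' O))
    rw [hT]
    exact (hg.mono interior_subset).isOpen_inter_preimage isOpen_interior hO

/-- A map which carries one locally invertible holomorphic map to another is itself conformal. -/
theorem hasDerivAt_of_comp_eventuallyEq {T g g' : ℂ → ℂ} {z a b : ℂ} (hg : HasStrictDerivAt g a z)
    (ha : a ≠ 0) (hg' : HasDerivAt g' b z) (h : ∀ᶠ y in 𝓝 z, T (g y) = g' y) :
    HasDerivAt T (b * a⁻¹) (g z) := by
  have hl := hg.to_localInverse ha
  have h1 : hg.localInverse g a z ha (g z) = z :=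
    (hg.hasStrictFDerivAt_equiv ha).localInverse_apply_image
  have h2 : ∀ᶠ w in 𝓝 (g z), g (hg.localInverse g a z ha w) = w :=
    (hg.hasStrictFDerivAt_equiv ha).eventually_right_inverse
  have hg'' : HasDerivAt g' b (hg.localInverse g a z ha (g z)) := by rwa [h1]
  refine (hg''.comp _ hl.hasDerivAt).congr_of_eventuallyEq ?_
  have h3 : Filter.Tendsto (hg.localInverse g a z ha) (𝓝 (g z)) (𝓝 z) := by
    simpa [h1] using hl.hasDerivAt.continuousAt.tendsto
  filter_upwards [h2, h3.eventually h] with w hw hw'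
  rw [hw] at hw'
  simpa using hw'

/-! ### Sector maps -/

/-- The quarter disc at the corner `0` of the unit square. -/
def quarterDisc : Set ℂ := {z | 0 ≤ z.re ∧ 0 ≤ z.im ∧ z.re ^ 2 + z.im ^ 2 ≤ 1}

/-- The map which places a quarter disc as the `k`-th of `m` sectors of the unit disc. -/
noncomputable def sectorMap (m k : ℕ) (z : ℂ) : ℂ :=
  Complex.exp (2 * Real.pi * Complex.I * (k / m)) * z ^ ((4 / m : ℝ) : ℂ)

section sector

variable {m : ℕ}

theorem sectorMap_zero (hm : 0 < m) (k : ℕ) : sectorMap m k 0 = 0 := by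
  simp [sectorMap, hm.ne']

theorem norm_sectorMap (m k : ℕ) (hm : 0 < m) (z : ℂ) :
    ‖sectorMap m k z‖ = ‖z‖ ^ (4 / m : ℝ) := by
  have h : (2 * Real.pi * Complex.I * (k / m) : ℂ) = ((2 * Real.pi * (k / m) : ℝ) : ℂ) * Complex.I := by
    push_cast; ring
  have : (4 / m : ℝ) ≠ 0 := by positivity
  rw [sectorMap, norm_mul, h, Complex.norm_exp_ofReal_mul_I, one_mul, Complex.norm_cpow_real]

theorem sectorMap_eq_exp (k : ℕ) {z : ℂ} (hz : z ≠ 0) :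
    sectorMap m k z = Complex.exp (((4 / m * Real.log ‖z‖ : ℝ) : ℂ) +
      ((2 * Real.pi / m * (k + 2 / Real.pi * z.arg) : ℝ) : ℂ) * Complex.I) := by
  rw [sectorMap, Complex.cpow_def_of_ne_zero hz, ← Complex.exp_add, Complex.log]
  have := Real.pi_ne_zero
  congr 1
  push_cast
  have : (Real.pi : ℂ) ≠ 0 := by exact_mod_cast this
  field_simp
  ring

theorem sectorMap_congr (hm : 0 < m) {k l : ℕ} (h : k ≡ l [MOD m]) (z : ℂ) :
    sectorMap m k z = sectorMap m l z := by
  rw [sectorMap, sectorMap]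
  congr 1
  rw [Complex.exp_eq_exp_iff_exists_int]
  obtain ⟨c, hc⟩ := (Nat.modEq_iff_dvd.1 h.symm)
  refine ⟨c, ?_⟩
  have : (k : ℂ) = l + m * c := by
    have : (k : ℤ) = l + m * c := by linarith
    exact_mod_cast this
  rw [this]
  have : (m : ℂ) ≠ 0 := by exact_mod_cast hm.ne'
  field_simp

/-- A quarter turn becomes a turn by one sector. The hypothesis says that `z ≠ 0` and `z.arg ≤ π /
2`, so adding `π / 2` does not cross the branch cut. The range goes beyond the quarter disc because
the identity also serves to continue charts across an edge. -/
theorem sectorMap_I_mul (k : ℕ) {z : ℂ} (hz : 0 < z.re ∨ z.im < 0) :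
    sectorMap m k (Complex.I * z) = sectorMap m (k + 1) z := by
  have hz0 : z ≠ 0 := by rintro rfl; simp at hz
  rw [sectorMap_eq_exp k (mul_ne_zero Complex.I_ne_zero hz0), sectorMap_eq_exp _ hz0]
  have harg : (Complex.I * z).arg = Real.pi / 2 + z.arg := by
    rw [Complex.arg_mul Complex.I_ne_zero hz0, Complex.arg_I]
    rw [Complex.arg_I]
    have h1 := Complex.neg_pi_lt_arg z
    have h2 : z.arg ≤ Real.pi / 2 := by
      rw [Complex.arg_le_pi_div_two_iff]; exact hz.imp le_of_lt id
    have := Real.pi_pos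
    constructor <;> linarith
  rw [harg]
  have := Real.pi_ne_zero
  congr 3
  · simp
  · congr 1
    push_cast
    field_simp
    ring

theorem arg_mem_of_normal {z : ℂ} (h : 0 < z.re ∧ 0 ≤ z.im) : 0 ≤ z.arg ∧ z.arg < Real.pi / 2 := by
  refine ⟨Complex.arg_nonneg_iff.2 h.2, ?_⟩
  have := (abs_lt.1 (Complex.abs_arg_lt_pi_div_two_iff.2 (Or.inl h.1))).2
  exact this

/-- On the half-open quarter the rescaled argument lies in `[0, 1)`. Hence the sector index is the
integer part of the argument of the image measured in sectors, and two indices below `m` that agree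
modulo `m` are equal. -/
theorem sectorMap_inj {k l : ℕ} (hk : k < m) (hl : l < m) {z w : ℂ}
    (hz : 0 < z.re ∧ 0 ≤ z.im) (hw : 0 < w.re ∧ 0 ≤ w.im)
    (h : sectorMap m k z = sectorMap m l w) : k = l ∧ z = w := by
  have hm : 0 < m := by omega
  have hm' : (0 : ℝ) < m := by exact_mod_cast hm
  have hz0 : z ≠ 0 := by rintro rfl; simp at hz
  have hw0 : w ≠ 0 := by rintro rfl; simp at hw
  have hnorm : ‖z‖ = ‖w‖ := by
    have h1 := congrArg norm h
    rw [norm_sectorMap m k hm, norm_sectorMap m l hm] at h1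
    exact (Real.rpow_left_inj (norm_nonneg _) (norm_nonneg _) (by positivity)).1 h1
  rw [sectorMap_eq_exp _ hz0, sectorMap_eq_exp _ hw0, Complex.exp_eq_exp_iff_exists_int] at h
  obtain ⟨c, hc⟩ := h
  have him := congrArg Complex.im hc
  simp only [Complex.add_im, Complex.ofReal_im, Complex.mul_im, Complex.ofReal_re, Complex.I_im,
    Complex.I_re, mul_one, mul_zero, add_zero, zero_add, Complex.intCast_re, Complex.intCast_im,
    Complex.mul_re, Complex.re_ofNat, Complex.im_ofNat, zero_mul, sub_zero] at him
  obtain ⟨a1, a2⟩ := arg_mem_of_normal hz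
  obtain ⟨b1, b2⟩ := arg_mem_of_normal hw
  have hpi := Real.pi_pos
  have e1 : ∀ x : ℝ, 2 / Real.pi * x = x / (Real.pi / 2) := fun x => by field_simp
  set x := 2 / Real.pi * z.arg with hx
  set y := 2 / Real.pi * w.arg with hy
  have hx1 : 0 ≤ x := by positivity
  have hy1 : 0 ≤ y := by positivity
  have hx2 : x < 1 := by rw [hx, e1, div_lt_one (by positivity)]; exact a2
  have hy2 : y < 1 := by rw [hy, e1, div_lt_one (by positivity)]; exact b2
  have h2 : (k : ℝ) + x = l + y + m * c := by
    have : 2 * Real.pi / m * (k + x) = 2 * Real.pi / m * (l + y + m * c) := by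
      rw [him]; field_simp
    exact mul_left_cancel₀ (by positivity) this
  have h3 : (k : ℤ) = l + m * c := by
    have h4 : ⌊(k : ℝ) + x⌋ = k := by
      rw [Int.floor_eq_iff]; push_cast; constructor <;> linarith
    have h5 : ⌊(l : ℝ) + y + m * c⌋ = l + m * c := by
      rw [Int.floor_eq_iff]; push_cast; constructor <;> linarith
    rw [← h4, h2, h5]
  have hc0 : c = 0 := by
    rcases lt_trichotomy c 0 with hc | hc | hc
    · have : (m : ℤ) * c ≤ m * (-1) := by
        apply mul_le_mul_of_nonneg_left <;> omega
      omega
    · exact hc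
    · have : (m : ℤ) * 1 ≤ m * c := by
        apply mul_le_mul_of_nonneg_left <;> omega
      omega
  subst hc0
  have hkl : k = l := by omega
  subst hkl
  refine ⟨rfl, Complex.ext_norm_arg hnorm ?_⟩
  have : x = y := by simpa using h2
  exact mul_left_cancel₀ (by positivity) this

theorem exists_sectorMap_eq (hm : 0 < m) {w : ℂ} (hw : ‖w‖ ≤ 1) :
    ∃ k < m, ∃ z ∈ quarterDisc, sectorMap m k z = w := by
  by_cases hw0 : w = 0
  · exact ⟨0, hm, 0, by simp [quarterDisc], by rw [sectorMap_zero hm, hw0]⟩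
  have hm' : (0 : ℝ) < m := by exact_mod_cast hm
  have hpi := Real.pi_pos
  obtain ⟨θ, hθ0, hθ1, hθ⟩ : ∃ θ : ℝ, 0 ≤ θ ∧ θ < 2 * Real.pi ∧
      w = ‖w‖ * Complex.exp (θ * Complex.I) := by
    rcases le_or_gt 0 w.arg with h | h
    · exact ⟨w.arg, h, by linarith [Complex.arg_le_pi w],
        (Complex.norm_mul_exp_arg_mul_I w).symm⟩
    · refine ⟨w.arg + 2 * Real.pi, by linarith [Complex.neg_pi_lt_arg w], by linarith, ?_⟩
      push_cast
      rw [add_mul, Complex.exp_add, Complex.exp_two_pi_mul_I, mul_one,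
        Complex.norm_mul_exp_arg_mul_I w]
  -- `τ` is the argument of `w` measured in sectors: its integer part selects the sector, its
  -- fractional part the angle `α` inside the quarter disc.
  set τ : ℝ := θ * m / (2 * Real.pi) with hτ
  have hτ0 : 0 ≤ τ := by positivity
  have hτ1 : τ < m := by
    rw [hτ, div_lt_iff₀ (by positivity)]; nlinarith
  set α : ℝ := (τ - ⌊τ⌋₊) * (Real.pi / 2) with hα
  have hf1 := Nat.floor_le hτ0
  have hf2 := Nat.lt_floor_add_one τ
  have hα0 : 0 ≤ α := mul_nonneg (by linarith) (by positivity)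
  have hα1 : α ≤ Real.pi / 2 := by
    have : τ - ⌊τ⌋₊ ≤ 1 := by linarith
    have := mul_le_mul_of_nonneg_right this (show 0 ≤ Real.pi / 2 by positivity)
    linarith
  have hwp : 0 < ‖w‖ := norm_pos_iff.2 hw0
  set r : ℝ := ‖w‖ ^ (m / 4 : ℝ) with hr
  have hr0 : 0 < r := by positivity
  have hr1 : r ≤ 1 := Real.rpow_le_one hwp.le hw (by positivity)
  set z : ℂ := r * (Complex.cos α + Complex.sin α * Complex.I) with hz
  have hznorm : ‖z‖ = r := by
    rw [hz, norm_mul, Complex.norm_cos_add_sin_mul_I]; simp [abs_of_pos hr0]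
  have hzarg : z.arg = α :=
    Complex.arg_mul_cos_add_sin_mul_I hr0 ⟨by linarith, by linarith⟩
  have hz0 : z ≠ 0 := by rw [← norm_pos_iff, hznorm]; exact hr0
  refine ⟨⌊τ⌋₊, (Nat.floor_lt hτ0).2 hτ1, z, ⟨?_, ?_, ?_⟩, ?_⟩
  · rw [← Complex.abs_arg_le_pi_div_two_iff, hzarg, abs_of_nonneg hα0]; exact hα1
  · rw [← Complex.arg_nonneg_iff, hzarg]; exact hα0
  · have := Complex.sq_norm z
    rw [Complex.normSq_apply, hznorm] at this
    nlinarith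
  · rw [sectorMap_eq_exp _ hz0, hznorm, hzarg, hθ]
    have e1 : 4 / m * Real.log r = Real.log ‖w‖ := by
      rw [hr, Real.log_rpow hwp]; field_simp
    have e2 : 2 * Real.pi / m * (⌊τ⌋₊ + 2 / Real.pi * α) = θ := by
      rw [hα, hτ]; field_simp; ring
    rw [e1, e2, Complex.exp_add, ← Complex.ofReal_exp, Real.exp_log hwp, ← hθ]

theorem continuousOn_sectorMap (hm : 0 < m) (k : ℕ) :
    ContinuousOn (sectorMap m k) {z | 0 ≤ z.re} := by
  intro z hz
  refine (ContinuousAt.mul continuousAt_const ?_).continuousWithinAt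
  refine Complex.continuousAt_cpow_const_of_re_pos (Or.inl hz) ?_
  rw [Complex.ofReal_re]; positivity

theorem exists_hasStrictDerivAt_sectorMap (hm : 0 < m) (k : ℕ) {z : ℂ} (hz : z ∈ Complex.slitPlane) :
    ∃ a ≠ 0, HasStrictDerivAt (sectorMap m k) a z := by
  have h := (hasStrictDerivAt_id z).cpow_const (c := ((4 / m : ℝ) : ℂ)) hz
  refine ⟨_, ?_, h.const_mul _⟩
  have hz0 := Complex.slitPlane_ne_zero hz
  have : ((4 / m : ℝ) : ℂ) ≠ 0 := by
    rw [Complex.ofReal_ne_zero]; positivity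
  simp only [id, mul_one]
  refine mul_ne_zero (Complex.exp_ne_zero _) (mul_ne_zero this ?_)
  rw [Complex.cpow_ne_zero_iff]
  exact Or.inl hz0

end sector

/-! ### Quadrangular rotation systems -/

/-- A rotation system of the complete graph on `V` all of whose faces are quadrangles: `σ v` is
the cyclic order of the neighbours of `v`, and the face to the left of the dart from `u` to `v` has
the vertices `u`, `v`, `(σ v).symm u` and `σ u v`. -/
structure IsQuadRotation {V : Type*} (σ : V → Equiv.Perm V) : Prop where
  isCycleOn : ∀ v, (σ v).IsCycleOn {v}ᶜ
  apply_third : ∀ u v, u ≠ v → σ ((σ v).symm u) (σ u v) = v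
  apply_fourth : ∀ u v, u ≠ v → σ (σ u v) u = (σ v).symm u

namespace IsQuadRotation

variable {V : Type*} {σ : V → Equiv.Perm V}

section basic
variable (h : IsQuadRotation σ)
include h

theorem apply_self (v : V) : σ v v = v := by
  by_contra hv
  exact ((h.isCycleOn v).apply_mem_iff.1 hv) rfl

theorem apply_ne_self {u v : V} (huv : u ≠ v) : σ v u ≠ v := fun hv =>
  huv ((σ v).injective (hv.trans (h.apply_self v).symm))

theorem inv_apply_ne_self {u v : V} (huv : u ≠ v) : (σ v).symm u ≠ v := fun hv =>
  huv (by rw [Equiv.symm_apply_eq, h.apply_self] at hv; exact hv)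

theorem inv_third {u v : V} (huv : u ≠ v) : (σ ((σ v).symm u)).symm v = σ u v := by
  rw [Equiv.symm_apply_eq, h.apply_third u v huv]

theorem inv_fourth {u v : V} (huv : u ≠ v) : (σ (σ u v)).symm ((σ v).symm u) = u := by
  rw [Equiv.symm_apply_eq, h.apply_fourth u v huv]

theorem third_ne_fourth {u v : V} (huv : u ≠ v) : (σ v).symm u ≠ σ u v := fun e => by
  have := h.apply_third u v huv
  rw [← e, h.apply_self] at this
  exact h.inv_apply_ne_self huv this

variable (hV : ∀ u v : V, ∃ w, w ≠ u ∧ w ≠ v)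
include hV

/-- A vertex with at least two neighbours has no fixed neighbour in its cyclic order. This is the
last ingredient for the four corners of a face to be distinct. -/
theorem apply_ne {u v : V} (huv : u ≠ v) : σ u v ≠ v := by
  obtain ⟨w, hwu, hwv⟩ := hV u v
  exact (h.isCycleOn u).apply_ne ⟨v, huv.symm, w, hwu, hwv.symm⟩ huv.symm

theorem inv_apply_ne {u v : V} (huv : u ≠ v) : (σ v).symm u ≠ u := fun e => by
  rw [Equiv.symm_apply_eq] at e
  exact h.apply_ne hV huv.symm e.symm

end basic

end IsQuadRotation

/-! ### Gluing the squares -/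

/-- The closed unit square. -/
def unitSquare : Set ℂ := {z | 0 ≤ z.re ∧ z.re ≤ 1 ∧ 0 ≤ z.im ∧ z.im ≤ 1}

section square

variable {V : Type*} [DecidableEq V] (σ : V → Equiv.Perm V)

/-- The darts of the face to the left of the dart from `u` to `v`. -/
def faceDarts (u v : V) : Finset (V × V) :=
  {(u, v), (v, (σ v).symm u), ((σ v).symm u, σ u v), (σ u v, u)}

/-- A function on the unit square which is positive inside and zero on the boundary. -/
def bump (z : ℂ) : ℝ := z.re * z.im * ((1 - z.re) * (1 - z.im))

/-- The point with coordinates `z` of the square to the left of the dart from `u` to `v`. It is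
described by its bilinear barycentric coordinates with respect to the vertices, and by the values
of bump functions for the faces. -/
def squarePoint (u v : V) (z : ℂ) : (V → ℝ) × (V × V → ℝ) :=
  (Pi.single u ((1 - z.re) * (1 - z.im)) + Pi.single v (z.re * (1 - z.im)) +
    Pi.single ((σ v).symm u) (z.re * z.im) + Pi.single (σ u v) ((1 - z.re) * z.im),
   fun p => if p ∈ faceDarts σ u v then bump z else 0)

theorem continuous_bump : Continuous bump := by unfold bump; fun_prop

theorem continuous_squarePoint (u v : V) : Continuous (squarePoint σ u v) := by
  unfold squarePoint
  refine Continuous.prodMk ?_ (continuous_pi fun p => ?_)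
  · refine continuous_pi fun x => ?_
    simp only [Pi.add_apply, Pi.single_apply]
    have : ∀ (P : Prop) [Decidable P] (f : ℂ → ℝ), Continuous f →
        Continuous fun z => if P then f z else 0 := fun P _ f hf => by
      split_ifs
      exacts [hf, continuous_const]
    refine (((this _ _ ?_).add (this _ _ ?_)).add (this _ _ ?_)).add (this _ _ ?_) <;> fun_prop
  · split_ifs
    exacts [continuous_bump, continuous_const]

/-- The surface obtained by gluing the squares. -/
def quadSurface : Set ((V → ℝ) × (V × V → ℝ)) :=
  {p | ∃ u v, u ≠ v ∧ ∃ z ∈ unitSquare, squarePoint σ u v z = p}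

variable {σ}

theorem bump_nonneg {z : ℂ} (hz : z ∈ unitSquare) : 0 ≤ bump z := by
  obtain ⟨h1, h2, h3, h4⟩ := hz
  exact mul_nonneg (mul_nonneg h1 h3) (mul_nonneg (by linarith) (by linarith))

theorem self_mem_faceDarts (u v : V) : (u, v) ∈ faceDarts σ u v := by simp [faceDarts]

theorem bump_pos_iff {z : ℂ} (hz : z ∈ unitSquare) :
    0 < bump z ↔ 0 < z.re ∧ z.re < 1 ∧ 0 < z.im ∧ z.im < 1 := by
  obtain ⟨h1, h2, h3, h4⟩ := hz
  constructor
  · intro h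
    unfold bump at h
    refine ⟨h1.lt_of_ne' ?_, h2.lt_of_ne ?_, h3.lt_of_ne' ?_, h4.lt_of_ne ?_⟩ <;>
    · intro e; rw [e] at h; simp at h
  · rintro ⟨h1, h2, h3, h4⟩
    exact mul_pos (mul_pos h1 h3) (mul_pos (by linarith) (by linarith))

theorem squarePoint_snd_self (u v : V) (z : ℂ) : (squarePoint σ u v z).2 (u, v) = bump z := by
  simp [squarePoint, self_mem_faceDarts]

theorem squarePoint_snd_eq_or (u v : V) (z : ℂ) (p : V × V) :
    (squarePoint σ u v z).2 p = bump z ∨ (squarePoint σ u v z).2 p = 0 := by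
  simp only [squarePoint]
  split_ifs <;> simp

/-- The segment from `u` to `v`. -/
def segPoint (u v : V) (t : ℝ) : (V → ℝ) × (V × V → ℝ) :=
  (Pi.single u (1 - t) + Pi.single v t, 0)

theorem segPoint_symm (u v : V) (t : ℝ) : segPoint u v t = segPoint v u (1 - t) := by
  simp [segPoint, add_comm]

theorem segPoint_zero (u v : V) : segPoint u v 0 = (Pi.single u 1, 0) := by
  simp [segPoint]

theorem segPoint_one (u v : V) : segPoint u v 1 = (Pi.single v 1, 0) := by
  simp [segPoint]

theorem segPoint_inj {u v u' v' : V} {s t : ℝ} (huv : u ≠ v) (hs0 : s ≠ 0) (hs1 : s ≠ 1)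
    (huv' : u' ≠ v') (e : segPoint u v s = segPoint u' v' t) :
    (u = u' ∧ v = v' ∧ s = t) ∨ (u = v' ∧ v = u' ∧ s = 1 - t) := by
  have e1 := congrFun (congrArg Prod.fst e) u
  have e2 := congrFun (congrArg Prod.fst e) v
  simp only [segPoint, Pi.add_apply, Pi.single_apply] at e1 e2
  have hs1' : 1 - s ≠ 0 := sub_ne_zero.2 hs1.symm
  by_cases h1 : u = u' <;> by_cases h2 : v = v' <;> by_cases h3 : u = v' <;> by_cases h4 : v = u' <;>
    simp_all

theorem squarePoint_ofReal (u v : V) (t : ℝ) : squarePoint σ u v t = segPoint u v t := by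
  ext p
  · simp [squarePoint, segPoint]
  · simp [squarePoint, segPoint, bump]

theorem squarePoint_ofReal_mul_I (u v : V) (t : ℝ) :
    squarePoint σ u v (t * Complex.I) = segPoint u (σ u v) t := by
  ext p
  · simp [squarePoint, segPoint]
  · simp [squarePoint, segPoint, bump]

theorem squarePoint_mem {u v : V} (huv : u ≠ v) {z : ℂ} (hz : z ∈ unitSquare) :
    squarePoint σ u v z ∈ quadSurface σ := ⟨u, v, huv, z, hz, rfl⟩

theorem quarterDisc_subset : quarterDisc ⊆ unitSquare := by
  rintro z ⟨h1, h2, h3⟩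
  exact ⟨h1, by nlinarith, h2, by nlinarith⟩

theorem isCompact_unitSquare : IsCompact unitSquare := by
  refine Metric.isCompact_of_isClosed_isBounded ?_ ?_
  · exact (isClosed_le continuous_const Complex.continuous_re).inter
      ((isClosed_le Complex.continuous_re continuous_const).inter
      ((isClosed_le continuous_const Complex.continuous_im).inter
      (isClosed_le Complex.continuous_im continuous_const)))
  · refine (Metric.isBounded_iff_subset_closedBall 0).2 ⟨2, fun z ⟨h1, h2, h3, h4⟩ => ?_⟩
    rw [mem_closedBall_zero_iff]
    refine (Complex.norm_le_abs_re_add_abs_im z).trans ?_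
    rw [abs_of_nonneg h1, abs_of_nonneg h3]; linarith

theorem isCompact_quarterDisc : IsCompact quarterDisc := by
  refine isCompact_unitSquare.of_isClosed_subset ?_ quarterDisc_subset
  exact (isClosed_le continuous_const Complex.continuous_re).inter
      ((isClosed_le continuous_const Complex.continuous_im).inter
      (isClosed_le (f := fun z : ℂ => z.re ^ 2 + z.im ^ 2) (by fun_prop) continuous_const))

theorem rotate_mem {z : ℂ} (hz : z ∈ unitSquare) : Complex.I * (1 - z) ∈ unitSquare := by
  obtain ⟨h1, h2, h3, h4⟩ := hz
  refine ⟨?_, ?_, ?_, ?_⟩ <;> simp <;> linarith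

theorem isCompact_quadSurface [Finite V] : IsCompact (quadSurface σ) := by
  have : quadSurface σ = ⋃ u, ⋃ v, ⋃ (_ : u ≠ v), squarePoint σ u v '' unitSquare := by
    ext p; simp [quadSurface]
  rw [this]
  exact isCompact_iUnion fun u => isCompact_iUnion fun v => isCompact_iUnion fun _ =>
    isCompact_unitSquare.image (continuous_squarePoint σ u v)

/-- The bump coordinates remember the face. If the dart `(u', v')` were not on the face of `(u, v)`,
its coordinate would force `bump z' = 0`, whereas the coordinate at `(u, v)` is positive. -/
theorem mem_faceDarts_of_eq {u v u' v' : V} {z z' : ℂ} (hb : 0 < bump z)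
    (e : squarePoint σ u v z = squarePoint σ u' v' z') : (u', v') ∈ faceDarts σ u v := by
  by_contra hn
  have e1 := congrFun (congrArg Prod.snd e) (u', v')
  rw [squarePoint_snd_self] at e1
  have e2 := congrFun (congrArg Prod.snd e) (u, v)
  rw [squarePoint_snd_self] at e2
  have : (squarePoint σ u v z).2 (u', v') = 0 := by simp [squarePoint, hn]
  rcases squarePoint_snd_eq_or (σ := σ) u' v' z' (u, v) with e3 | e3 <;> linarith

theorem squarePoint_fst_of_ne {u v x : V} (z : ℂ) (h1 : x ≠ u) (h2 : x ≠ v)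
    (h3 : x ≠ (σ v).symm u) (h4 : x ≠ σ u v) : (squarePoint σ u v z).1 x = 0 := by
  simp [squarePoint, h1, h2, h3, h4]

variable (h : IsQuadRotation σ)
include h

/-- The map `z ↦ i (1 - z)` is the quarter turn of the square that moves the corner `1` to the
origin, so it changes the base dart to the next dart of the face. -/
theorem squarePoint_rotate {u v : V} (huv : u ≠ v) (z : ℂ) :
    squarePoint σ v ((σ v).symm u) (Complex.I * (1 - z)) = squarePoint σ u v z := by
  have e4 : σ v ((σ v).symm u) = u := Equiv.apply_symm_apply _ _
  have e3 := h.inv_third huv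
  have hb : bump (Complex.I * (1 - z)) = bump z := by simp [bump]; ring
  have hf : faceDarts σ v ((σ v).symm u) = faceDarts σ u v := by
    ext p
    simp only [faceDarts, e3, e4, Finset.mem_insert, Finset.mem_singleton]
    tauto
  unfold squarePoint
  rw [hb, hf, e3, e4]
  ext x
  · simp [sub_sub_cancel, mul_comm]; ring
  · rfl

/-- The square may be based at any of its corners. -/
theorem exists_rebase {u v x : V} (huv : u ≠ v) {z : ℂ} (hx : (squarePoint σ u v z).1 x ≠ 0) :
    ∃ y, x ≠ y ∧ ∃ c d : ℂ, c ≠ 0 ∧ (∀ w ∈ unitSquare, c * w + d ∈ unitSquare) ∧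
      ∀ w, squarePoint σ u v w = squarePoint σ x y (c * w + d) ∧ bump (c * w + d) = bump w := by
  -- One quarter turn composed with an affine change of base already found; at most three turns
  -- reach the corner `x`.
  have step : ∀ {a b : V}, a ≠ b → ∀ c d : ℂ, c ≠ 0 → (∀ w ∈ unitSquare, c * w + d ∈ unitSquare) →
      (∀ w, squarePoint σ u v w = squarePoint σ a b (c * w + d) ∧ bump (c * w + d) = bump w) →
      b ≠ (σ b).symm a ∧ ∃ c d : ℂ, c ≠ 0 ∧ (∀ w ∈ unitSquare, c * w + d ∈ unitSquare) ∧
      ∀ w, squarePoint σ u v w = squarePoint σ b ((σ b).symm a) (c * w + d) ∧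
        bump (c * w + d) = bump w := by
    intro a b hab c d hc hS hw
    have e : ∀ w, -Complex.I * c * w + Complex.I * (1 - d) = Complex.I * (1 - (c * w + d)) :=
      fun w => by ring
    refine ⟨(h.inv_apply_ne_self hab).symm, -Complex.I * c, Complex.I * (1 - d),
      mul_ne_zero (neg_ne_zero.2 Complex.I_ne_zero) hc, fun w hw' => ?_, fun w => ?_⟩
    · rw [e]; exact rotate_mem (hS w hw')
    · rw [e, squarePoint_rotate h hab, (hw w).1, ← (hw w).2]
      exact ⟨rfl, by simp [bump]; ring⟩
  by_cases h1 : x = u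
  · subst h1; exact ⟨v, huv, 1, 0, one_ne_zero, by simp, by simp⟩
  obtain ⟨n1, c1, d1, k1, l1, m1⟩ := step huv 1 0 one_ne_zero (by simp) (by simp)
  by_cases h2 : x = v
  · subst h2; exact ⟨_, n1, c1, d1, k1, l1, m1⟩
  obtain ⟨n2, c2, d2, k2, l2, m2⟩ := step n1 c1 d1 k1 l1 m1
  by_cases h3 : x = (σ v).symm u
  · subst h3; exact ⟨_, n2, c2, d2, k2, l2, m2⟩
  obtain ⟨n3, c3, d3, k3, l3, m3⟩ := step n2 c2 d2 k2 l2 m2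
  by_cases h4 : x = σ u v
  · subst h4
    rw [h.inv_third huv] at n3 m3
    exact ⟨_, n3, c3, d3, k3, l3, m3⟩
  · exact absurd (squarePoint_fst_of_ne z h1 h2 h3 h4) hx

/-- Every point with a positive coordinate at `x` lies in a square based at `x`. -/
theorem exists_squarePoint_of_pos {u v x : V} (huv : u ≠ v) {z : ℂ} (hz : z ∈ unitSquare)
    (hx : (squarePoint σ u v z).1 x ≠ 0) :
    ∃ y, x ≠ y ∧ ∃ w ∈ unitSquare, squarePoint σ u v z = squarePoint σ x y w := by
  obtain ⟨y, hy, c, d, -, hS, hw⟩ := exists_rebase h huv hx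
  exact ⟨y, hy, _, hS z hz, (hw z).1⟩

variable (hV : ∀ u v : V, ∃ w, w ≠ u ∧ w ≠ v)
include hV

theorem squarePoint_fst {u v : V} (huv : u ≠ v) (z : ℂ) :
    (squarePoint σ u v z).1 u = (1 - z.re) * (1 - z.im) ∧
    (squarePoint σ u v z).1 v = z.re * (1 - z.im) ∧
    (squarePoint σ u v z).1 ((σ v).symm u) = z.re * z.im ∧
    (squarePoint σ u v z).1 (σ u v) = (1 - z.re) * z.im := by
  have h1 := h.apply_ne hV huv
  have h2 := h.inv_apply_ne hV huv
  have h3 := h.apply_ne_self huv.symm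
  have h4 := h.inv_apply_ne_self huv
  have h5 := h.third_ne_fourth huv
  simp [squarePoint, huv, huv.symm, h1, h1.symm, h2, h2.symm, h3, h3.symm, h4,
    h4.symm, h5, h5.symm]

theorem squarePoint_injective {u v : V} (huv : u ≠ v) :
    Function.Injective (squarePoint σ u v) := by
  intro z w e
  obtain ⟨a1, a2, a3, a4⟩ := squarePoint_fst h hV huv z
  obtain ⟨b1, b2, b3, b4⟩ := squarePoint_fst h hV huv w
  rw [e] at a1 a2 a3 a4
  apply Complex.ext <;> linarith

/-- An interior point determines its face, and only one dart of the face leaves the corner `v`,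
because the corners are distinct. -/
theorem eq_of_squarePoint_eq {v u u' : V} (hu : v ≠ u) {z z' : ℂ}
    (hb : 0 < bump z) (e : squarePoint σ v u z = squarePoint σ v u' z') : u = u' ∧ z = z' := by
  have hm := mem_faceDarts_of_eq hb e
  have h2 := h.inv_apply_ne hV hu
  have h3 := h.apply_ne_self hu.symm
  have : u = u' := by
    simp only [faceDarts, Finset.mem_insert, Finset.mem_singleton, Prod.mk.injEq] at hm
    rcases hm with hm | hm | hm | hm
    · exact hm.2.symm
    · exact absurd hm.1 hu
    · exact absurd hm.1.symm h2
    · exact absurd hm.1.symm h3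
  subst this
  exact ⟨rfl, squarePoint_injective h hV hu e⟩

end square

/-! ### Charts at the vertices -/

/-- `p` numbers the elements other than `v` in the cyclic order given by `f`. -/
structure IsCyclicNumbering {V : Type*} (f : Equiv.Perm V) (v : V) (m : ℕ) (p : V → ℕ) : Prop where
  lt : ∀ u, u ≠ v → p u < m
  inj : ∀ u u', u ≠ v → u' ≠ v → p u = p u' → u = u'
  surj : ∀ k < m, ∃ u, u ≠ v ∧ p u = k
  modEq : ∀ u, u ≠ v → p (f u) ≡ p u + 1 [MOD m]

theorem exists_isCyclicNumbering {V : Type*} [Fintype V] [DecidableEq V] {f : Equiv.Perm V} {v : V}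
    (hf : f.IsCycleOn {v}ᶜ) {w : V} (hw : w ≠ v) :
    ∃ p, IsCyclicNumbering f v (Fintype.card V - 1) p := by
  set s : Finset V := Finset.univ.erase v with hs
  have hsv : (s : Set V) = {v}ᶜ := by ext; simp [hs]
  have hmem : ∀ {u}, u ≠ v → u ∈ s := fun hu => by simp [hs, hu]
  have hcard : s.card = Fintype.card V - 1 := by
    rw [hs, Finset.card_erase_of_mem (Finset.mem_univ _), Finset.card_univ]
  rw [← hsv] at hf
  have hex : ∀ u, u ≠ v → ∃ n < s.card, (f ^ n) w = u := fun u hu =>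
    hf.exists_pow_eq (hmem hw) (hmem hu)
  choose! p hp1 hp2 using hex
  have hfv : ∀ u, u ≠ v → f u ≠ v := fun u hu => by
    have : f u ∈ s := by
      have := (hf.apply_mem_iff (x := u)).2 (by exact_mod_cast hmem hu)
      exact_mod_cast this
    simpa [hs] using this
  have hpow : ∀ k : ℕ, (f ^ k) w ≠ v := by
    intro k
    induction k with
    | zero => simpa using hw
    | succ k ih => rw [pow_succ', Equiv.Perm.mul_apply]; exact hfv _ ih
  refine ⟨p, ⟨fun u hu => hcard ▸ hp1 u hu, fun u u' hu hu' e => ?_, fun k hk => ?_,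
    fun u hu => ?_⟩⟩
  · rw [← hp2 u hu, ← hp2 u' hu', e]
  · refine ⟨(f ^ k) w, hpow k, ?_⟩
    have := hp2 _ (hpow k)
    rw [hf.pow_apply_eq_pow_apply (hmem hw)] at this
    exact this.eq_of_lt_of_lt (hp1 _ (hpow k)) (hcard ▸ hk)
  · rw [← hcard, ← hf.pow_apply_eq_pow_apply (hmem hw), hp2 _ (hfv u hu), pow_succ',
      Equiv.Perm.mul_apply, hp2 u hu]

section chart

variable {V : Type*} [DecidableEq V] {σ : V → Equiv.Perm V} (h : IsQuadRotation σ)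
  (hV : ∀ u v : V, ∃ w, w ≠ u ∧ w ≠ v)

/-- The threshold `1 / 5` satisfies two demands. It is below `1 / 4`, so that the stars cover the
surface. It exceeds `(√2 - 1)² / 2`, the maximum of `(1 - x) (1 - y)` on the part of the square
outside the open unit disc, so that the star lies in the quarter discs. -/
theorem mem_quarterDisc_of_hat {z : ℂ} (hz : z ∈ unitSquare)
    (h : 1 / 5 < (1 - z.re) * (1 - z.im)) : z ∈ quarterDisc ∧ z.re ^ 2 + z.im ^ 2 < 1 := by
  obtain ⟨h1, h2, h3, h4⟩ := hz
  have : z.re ^ 2 + z.im ^ 2 < 1 := by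
    by_contra! hc
    have e1 : 1 ≤ z.re + z.im := by nlinarith
    have e2 : z.re + z.im < 6 / 5 := by nlinarith [sq_nonneg (z.re - z.im)]
    nlinarith
  exact ⟨⟨h1, h3, this.le⟩, this⟩

include h in
/-- Every point of a quarter disc may be represented in the half-open quarter disc. -/
theorem exists_normal_form {m : ℕ} {v : V} {p : V → ℕ}
    (hp : IsCyclicNumbering (σ v) v m p) (hm : 0 < m) {u : V} (hu : u ≠ v) {z : ℂ}
    (hz : z ∈ quarterDisc) :
    ∃ u' z', u' ≠ v ∧ z' ∈ quarterDisc ∧ (z' = 0 ∨ 0 < z'.re ∧ 0 ≤ z'.im) ∧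
      squarePoint σ v u z = squarePoint σ v u' z' ∧
      sectorMap m (p u) z = sectorMap m (p u') z' := by
  obtain ⟨h1, h2, h3⟩ := hz
  rcases h1.eq_or_lt with h1' | h1'
  · rcases h2.eq_or_lt with h2' | h2'
    · exact ⟨u, z, hu, ⟨h1, h2, h3⟩, Or.inl (Complex.ext h1'.symm h2'.symm), rfl, rfl⟩
    · have hz : z = z.im * Complex.I := by apply Complex.ext <;> simp [← h1']
      -- The imaginary side of the square at `u` is the real side of the next square around `v`, the
      -- one at `σ v u`.
      refine ⟨σ v u, z.im, h.apply_ne_self hu, ⟨by simpa using h2, by simp, ?_⟩, ?_, ?_, ?_⟩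
      · simpa [← h1'] using h3
      · simpa using Or.inr h2'
      · rw [squarePoint_ofReal]
        conv_lhs => rw [hz]
        rw [squarePoint_ofReal_mul_I]
      · rw [sectorMap_congr hm (hp.modEq u hu), ← sectorMap_I_mul _ (by simpa using h2'),
          mul_comm, ← hz]
  · exact ⟨u, z, hu, ⟨h1, h2, h3⟩, Or.inr ⟨h1', h2⟩, rfl, rfl⟩

/-- The sides `re = 1` and `im = 1` touch the quarter disc only at `1` and at `i`, and the half-open
form excludes `i`. -/
theorem eq_ofReal_of_bump_eq_zero {z : ℂ} (hz : z ∈ quarterDisc)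
    (hn : z = 0 ∨ 0 < z.re ∧ 0 ≤ z.im) (hb : bump z = 0) : z = z.re := by
  rcases hn with rfl | ⟨h1, h2⟩
  · simp
  obtain ⟨_, _, h3⟩ := hz
  suffices z.im = 0 from Complex.ext (by simp) (by simpa using this)
  unfold bump at hb
  simp only [mul_eq_zero, sub_eq_zero] at hb
  rcases hb with (hb | hb) | hb | hb
  · exact absurd hb h1.ne'
  · exact hb
  · rw [← hb] at h3; nlinarith
  · rw [← hb] at h3; nlinarith

include h hV in
-- Interior points are separated by the bump coordinates, points on the real side by the barycentric
-- ones. Only the corner is shared by different squares. With `sectorMap_normal_form_injective` this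
-- shows that the gluing in the surface and the gluing of sectors identify the same points.
theorem normal_form_injective {v u u' : V} (hu : u ≠ v) (hu' : u' ≠ v) {z z' : ℂ}
    (hz : z ∈ quarterDisc) (hz' : z' ∈ quarterDisc) (hn : z = 0 ∨ 0 < z.re ∧ 0 ≤ z.im)
    (hn' : z' = 0 ∨ 0 < z'.re ∧ 0 ≤ z'.im)
    (e : squarePoint σ v u z = squarePoint σ v u' z') : z = z' ∧ (z = 0 ∨ u = u') := by
  rcases (bump_nonneg (quarterDisc_subset hz)).eq_or_lt with hb | hb
  · rcases (bump_nonneg (quarterDisc_subset hz')).eq_or_lt with hb' | hb'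
    · have e1 := eq_ofReal_of_bump_eq_zero hz hn hb.symm
      have e2 := eq_ofReal_of_bump_eq_zero hz' hn' hb'.symm
      rw [e1, e2, squarePoint_ofReal, squarePoint_ofReal] at e
      have e3 := congrFun (congrArg Prod.fst e) v
      have e4 := congrFun (congrArg Prod.fst e) u
      simp only [segPoint, Pi.add_apply, Pi.single_apply, hu.symm, hu'.symm, hu, if_true,
        if_false] at e3 e4
      have e5 : z.re = z'.re := by linarith
      refine ⟨by rw [e1, e2, e5], ?_⟩
      by_cases huu : u = u'
      · exact Or.inr huu
      · left
        rw [if_neg huu] at e4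
        rw [e1]
        have : z.re = 0 := by linarith
        simp [this]
    · obtain ⟨rfl, rfl⟩ := eq_of_squarePoint_eq h hV hu'.symm hb' e.symm
      exact ⟨rfl, Or.inr rfl⟩
  · obtain ⟨rfl, rfl⟩ := eq_of_squarePoint_eq h hV hu.symm hb e
    exact ⟨rfl, Or.inr rfl⟩

theorem sectorMap_normal_form_injective {m : ℕ} (hm : 0 < m) {k l : ℕ} (hk : k < m) (hl : l < m)
    {z z' : ℂ} (hn : z = 0 ∨ 0 < z.re ∧ 0 ≤ z.im) (hn' : z' = 0 ∨ 0 < z'.re ∧ 0 ≤ z'.im)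
    (e : sectorMap m k z = sectorMap m l z') : z = z' ∧ (z = 0 ∨ k = l) := by
  have h0 : ∀ {k : ℕ} {z : ℂ}, sectorMap m k z = 0 → z = 0 := by
    intro k z hz
    have := congrArg norm hz
    rw [norm_sectorMap m k hm, norm_zero,
      Real.rpow_eq_zero (norm_nonneg _) (by positivity)] at this
    exact norm_eq_zero.1 this
  rcases hn with rfl | hn
  · rw [sectorMap_zero hm] at e
    exact ⟨(h0 e.symm).symm, Or.inl rfl⟩
  rcases hn' with rfl | hn'
  · rw [sectorMap_zero hm] at e
    exact ⟨h0 e, Or.inl (h0 e)⟩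
  obtain ⟨e1, e2⟩ := sectorMap_inj hk hl hn hn' e
  exact ⟨e2, Or.inr e1⟩

include h hV in
/-- The star of a vertex is a coordinate disc. -/
theorem exists_chart [Finite V] {m : ℕ} (hm : 0 < m) {v : V} {p : V → ℕ}
    (hp : IsCyclicNumbering (σ v) v m p) :
    ∃ e : OpenPartialHomeomorph (quadSurface σ) ℂ, e.source = {x | 1 / 5 < x.1.1 v} ∧
      ∀ u (hu : v ≠ u) z (hz : z ∈ unitSquare), 1 / 5 < (1 - z.re) * (1 - z.im) →
        e ⟨squarePoint σ v u z, squarePoint_mem hu hz⟩ = sectorMap m (p u) z := by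
  have : CompactSpace quarterDisc := isCompact_iff_compactSpace.1 isCompact_quarterDisc
  obtain ⟨w, hw, -⟩ := hV v v
  -- The disjoint union of the quarter discs around `v`. It maps to the plane by `a` and to the
  -- surface by `b`; once these have the same fibres, the chart is `a` after an inverse of `b`.
  let K := {u // u ≠ v} × quarterDisc
  let : TopologicalSpace {u // u ≠ v} := ⊥
  have : DiscreteTopology {u // u ≠ v} := ⟨rfl⟩
  let a : K → ℂ := fun k => sectorMap m (p k.1) k.2
  let b : K → quadSurface σ := fun k =>
    ⟨squarePoint σ v k.1 k.2, squarePoint_mem k.1.2.symm (quarterDisc_subset k.2.2)⟩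
  have : Nonempty K := ⟨⟨w, hw⟩, 0, by simp [quarterDisc]⟩
  have ha : Continuous a := by
    refine continuous_prod_of_discrete_left.2 fun u => ?_
    exact ((continuousOn_sectorMap hm (p u)).mono fun z hz => hz.1).domRestrict
  have hb : Continuous b := by
    refine continuous_prod_of_discrete_left.2 fun u => ?_
    exact ((continuous_squarePoint σ v u).comp continuous_subtype_val).subtype_mk _
  have hab : ∀ k l, a k = a l ↔ b k = b l := by
    rintro ⟨⟨u, hu⟩, z, hz⟩ ⟨⟨u', hu'⟩, z', hz'⟩
    obtain ⟨x, y, hx, hy, hn, e1, e2⟩ := exists_normal_form h hp hm hu hz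
    obtain ⟨x', y', hx', hy', hn', e1', e2'⟩ := exists_normal_form h hp hm hu' hz'
    simp only [a, b, Subtype.mk.injEq, e1, e2, e1', e2']
    constructor
    · intro e
      obtain ⟨rfl, e4⟩ := sectorMap_normal_form_injective hm (hp.lt x hx) (hp.lt x' hx') hn hn' e
      rcases e4 with rfl | e4
      · have := squarePoint_ofReal (σ := σ) v x 0
        have h' := squarePoint_ofReal (σ := σ) v x' 0
        rw [segPoint_zero, Complex.ofReal_zero] at this h'
        rw [this, h']
      · rw [hp.inj x x' hx hx' e4]
    · intro e
      obtain ⟨rfl, e4⟩ := normal_form_injective h hV hx hx' hy hy' hn hn' e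
      rcases e4 with rfl | rfl
      · rw [sectorMap_zero hm, sectorMap_zero hm]
      · rfl
  have hO : IsOpen {x : quadSurface σ | 1 / 5 < x.1.1 v} :=
    isOpen_lt continuous_const (by fun_prop)
  have hat : ∀ {u} (_ : v ≠ u) (z : ℂ), (squarePoint σ v u z).1 v = (1 - z.re) * (1 - z.im) :=
    fun hu z => (squarePoint_fst h hV hu z).1
  have hOb : {x : quadSurface σ | 1 / 5 < x.1.1 v} ⊆ range b := by
    rintro ⟨_, s, t, hst, z, hz, rfl⟩ hx
    simp only [mem_ofPred_eq] at hx
    obtain ⟨y, hy, z', hz', e⟩ := exists_squarePoint_of_pos h hst hz (x := v)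
      (by linarith : (0 : ℝ) < _).ne'
    rw [e, hat hy] at hx
    exact ⟨(⟨y, hy.symm⟩, ⟨z', (mem_quarterDisc_of_hat hz' hx).1⟩), Subtype.ext e.symm⟩
  have hOa : a '' (b ⁻¹' {x : quadSurface σ | 1 / 5 < x.1.1 v}) ⊆ interior (range a) := by
    have hball : Metric.ball (0 : ℂ) 1 ⊆ range a := by
      intro w hw
      rw [mem_ball_zero_iff] at hw
      obtain ⟨k, hk, z, hz, e⟩ := exists_sectorMap_eq hm hw.le
      obtain ⟨u, hu, rfl⟩ := hp.surj k hk
      exact ⟨(⟨u, hu⟩, ⟨z, hz⟩), e⟩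
    refine Subset.trans ?_ (interior_maximal hball Metric.isOpen_ball)
    rintro _ ⟨⟨⟨u, hu⟩, z, hz⟩, hx, rfl⟩
    simp only [mem_preimage, mem_ofPred_eq, b, hat hu.symm] at hx
    have := (mem_quarterDisc_of_hat (quarterDisc_subset hz) hx).2
    rw [mem_ball_zero_iff, norm_sectorMap m _ hm]
    refine Real.rpow_lt_one (norm_nonneg _) ?_ (by positivity)
    have h2 := Complex.sq_norm z
    rw [Complex.normSq_apply] at h2
    have := norm_nonneg z
    simp only
    nlinarith
  obtain ⟨e, he1, -, he2⟩ := exists_openPartialHomeomorph_of_same_fibres ha hb hab hO hOb hOa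
  refine ⟨e, he1, fun u hu z hz hz' => ?_⟩
  refine he2 (⟨u, hu.symm⟩, ⟨z, (mem_quarterDisc_of_hat hz hz').1⟩) ?_
  simp only [mem_ofPred_eq, b, hat hu]
  exact hz'

end chart

/-! ### Coordinate changes -/

section transition

variable {V : Type*} [DecidableEq V] {σ : V → Equiv.Perm V}

/-- A chart on the star of the vertex `v`, given by sector maps. -/
structure IsStarChart (σ : V → Equiv.Perm V) (m : ℕ) (v : V) (p : V → ℕ)
    (e : OpenPartialHomeomorph (quadSurface σ) ℂ) : Prop where
  source_eq : e.source = {x | 1 / 5 < x.1.1 v}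
  apply_eq : ∀ u (hu : v ≠ u) z (hz : z ∈ unitSquare), 1 / 5 < (1 - z.re) * (1 - z.im) →
    e ⟨squarePoint σ v u z, squarePoint_mem hu hz⟩ = sectorMap m (p u) z

variable {m : ℕ} {v u : V} {p q : V → ℕ} {e e' : OpenPartialHomeomorph (quadSurface σ) ℂ}

theorem hasDerivAt_transition {z a b : ℂ} {g g' : ℂ → ℂ} (hg : HasStrictDerivAt g a z) (ha : a ≠ 0)
    (hg' : HasDerivAt g' b z) (hb : b ≠ 0)
    (hX : ∀ᶠ y in 𝓝 z, ∃ X ∈ e.source, e X = g y ∧ e' X = g' y) :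
    ∃ c ≠ 0, HasDerivAt (e.symm.trans e') c (g z) := by
  refine ⟨_, mul_ne_zero hb (inv_ne_zero ha), hasDerivAt_of_comp_eventuallyEq hg ha hg' ?_⟩
  filter_upwards [hX] with y hy
  obtain ⟨X, hX, h1, h2⟩ := hy
  simp only [OpenPartialHomeomorph.coe_trans, Function.comp_apply]
  rw [← h1, e.left_inv hX, h2]

theorem isOpen_interior_square : IsOpen {z : ℂ | 0 < z.re ∧ z.re < 1 ∧ 0 < z.im ∧ z.im < 1} :=
  (isOpen_lt continuous_const Complex.continuous_re).inter
    ((isOpen_lt Complex.continuous_re continuous_const).inter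
    ((isOpen_lt continuous_const Complex.continuous_im).inter
    (isOpen_lt Complex.continuous_im continuous_const)))

variable (h : IsQuadRotation σ) (hV : ∀ u v : V, ∃ w, w ≠ u ∧ w ≠ v)
include h hV

/-- Inside a square both charts are sector maps, in coordinates that differ by the affine change of
base. -/
theorem IsStarChart.exists_hasDerivAt_of_interior (he : IsStarChart σ m v p e)
    (he' : IsStarChart σ m u q e') (hm : 0 < m) {y : V} (hy : v ≠ y) {z : ℂ}
    (hz : z ∈ unitSquare) (hb : 0 < bump z) (hxv : 1 / 5 < (squarePoint σ v y z).1 v)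
    (hxu : 1 / 5 < (squarePoint σ v y z).1 u) :
    ∃ c ≠ 0, HasDerivAt (e.symm.trans e') c (e ⟨squarePoint σ v y z, squarePoint_mem hy hz⟩) := by
  have hin := (bump_pos_iff hz).1 hb
  obtain ⟨y', hy', c, d, hc, hS, hcd⟩ := exists_rebase h hy (z := z) (x := u)
    (by linarith : (0 : ℝ) < _).ne'
  have hin' := (bump_pos_iff (hS z hz)).1 (by rw [(hcd z).2]; exact hb)
  have hat : ∀ {u v : V} (_ : u ≠ v) (z : ℂ), (squarePoint σ u v z).1 u = (1 - z.re) * (1 - z.im) :=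
    fun hu z => (squarePoint_fst h hV hu z).1
  rw [he.apply_eq y hy z hz (by rwa [hat hy] at hxv)]
  obtain ⟨a, ha, hd⟩ := exists_hasStrictDerivAt_sectorMap hm (p y) (z := z) (Or.inl hin.1)
  obtain ⟨b, hb, hd'⟩ := exists_hasStrictDerivAt_sectorMap hm (q y') (z := c * z + d)
    (Or.inl hin'.1)
  have haff : HasDerivAt (fun w => c * w + d) c z := by
    simpa using ((hasDerivAt_id z).const_mul c).add_const d
  refine hasDerivAt_transition hd ha (hd'.hasDerivAt.comp z haff) (mul_ne_zero hb hc) ?_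
  have o1 : ∀ᶠ w in 𝓝 z, 1 / 5 < (squarePoint σ v y w).1 v :=
    ((continuous_apply v).comp (continuous_fst.comp (continuous_squarePoint σ v y))).continuousAt.eventually
      (lt_mem_nhds hxv)
  have o2 : ∀ᶠ w in 𝓝 z, 1 / 5 < (squarePoint σ v y w).1 u :=
    ((continuous_apply u).comp (continuous_fst.comp (continuous_squarePoint σ v y))).continuousAt.eventually
      (lt_mem_nhds hxu)
  filter_upwards [o1, o2, isOpen_interior_square.mem_nhds hin] with w h1 h2 h3
  have hw : w ∈ unitSquare := ⟨h3.1.le, h3.2.1.le, h3.2.2.1.le, h3.2.2.2.le⟩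
  refine ⟨⟨squarePoint σ v y w, squarePoint_mem hy hw⟩, ?_, ?_, ?_⟩
  · rw [he.source_eq]; exact h1
  · exact he.apply_eq y hy w hw (by rwa [hat hy] at h1)
  · have : (⟨squarePoint σ v y w, squarePoint_mem hy hw⟩ : quadSurface σ) =
        ⟨squarePoint σ u y' (c * w + d), squarePoint_mem hy' (hS w hw)⟩ :=
      Subtype.ext (hcd w).1
    rw [this]
    refine he'.apply_eq y' hy' _ (hS w hw) ?_
    rwa [(hcd w).1, hat hy'] at h2

/-- One sector map describes each chart on both sides of the edge. The coordinate of the square on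
one side is continued across the real axis, and `sectorMap_I_mul` identifies the continuation with
the adjacent sector. Hence the transition is conformal on the edge as well. -/
theorem IsStarChart.exists_hasDerivAt_of_segment (hvu : v ≠ u) (he : IsStarChart σ m v p e)
    (he' : IsStarChart σ m u q e') (hm : 0 < m) (hp : IsCyclicNumbering (σ v) v m p)
    (hq : IsCyclicNumbering (σ u) u m q) {t : ℝ} (h0 : 1 / 5 < t)
    (h1 : 1 / 5 < 1 - t) (ht : (t : ℂ) ∈ unitSquare) :
    ∃ c ≠ 0, HasDerivAt (e.symm.trans e') c (e ⟨squarePoint σ v u t, squarePoint_mem hvu ht⟩) := by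
  have hat : ∀ {u v : V} (_ : u ≠ v) (z : ℂ), (squarePoint σ u v z).1 u = (1 - z.re) * (1 - z.im) :=
    fun hu z => (squarePoint_fst h hV hu z).1
  set b := (σ u).symm v with hb
  have hub : u ≠ b := (h.inv_apply_ne_self hvu).symm
  set b' := (σ v).symm u with hb'
  have hvb' : v ≠ b' := (h.inv_apply_ne_self hvu.symm).symm
  rw [he.apply_eq u hvu t ht (by simpa using h1)]
  obtain ⟨a, ha, hd⟩ := exists_hasStrictDerivAt_sectorMap hm (p u) (z := t)
    (Or.inl (by simp; linarith))
  obtain ⟨a', ha', hd'⟩ := exists_hasStrictDerivAt_sectorMap hm (q b) (z := Complex.I * (1 - t))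
    (Or.inr (by simp; intro ht; linarith))
  have haff : HasDerivAt (fun w : ℂ => Complex.I * (1 - w)) (-Complex.I) t := by
    simpa using ((hasDerivAt_id (t : ℂ)).const_sub 1).const_mul Complex.I
  refine hasDerivAt_transition hd ha (hd'.hasDerivAt.comp (t : ℂ) haff)
    (mul_ne_zero ha' (neg_ne_zero.2 Complex.I_ne_zero)) ?_
  have ev : ∀ f : ℂ → ℝ, Continuous f → ∀ r, r < f t → ∀ᶠ w in 𝓝 (t : ℂ), r < f w :=
    fun f hf r hr => hf.continuousAt.eventually (lt_mem_nhds hr)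
  filter_upwards [ev (fun w => w.re) (by fun_prop) 0 (by simp; linarith),
    ev (fun w => 1 - w.re) (by fun_prop) 0 (by simp; linarith),
    ev (fun w => 1 - w.im) (by fun_prop) 0 (by simp),
    ev (fun w => 1 + w.im) (by fun_prop) 0 (by simp),
    ev (fun w => (1 - w.re) * (1 - w.im)) (by fun_prop) (1 / 5) (by simpa using h1),
    ev (fun w => w.re * (1 - w.im)) (by fun_prop) (1 / 5) (by simpa using h0),
    ev (fun w => (1 - w.re) * (1 + w.im)) (by fun_prop) (1 / 5) (by simpa using h1),
    ev (fun w => w.re * (1 + w.im)) (by fun_prop) (1 / 5) (by simpa using h0)]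
    with w w1 w2 w3 w4 w5 w6 w7 w8
  rcases le_or_gt 0 w.im with hw | hw
  · have hwS : w ∈ unitSquare := ⟨w1.le, by linarith, hw, by linarith⟩
    refine ⟨⟨squarePoint σ v u w, squarePoint_mem hvu hwS⟩, ?_, ?_, ?_⟩
    · rw [he.source_eq, mem_ofPred_eq, hat hvu]; exact w5
    · exact he.apply_eq u hvu w hwS w5
    · have : (⟨squarePoint σ v u w, squarePoint_mem hvu hwS⟩ : quadSurface σ) =
          ⟨squarePoint σ u b (Complex.I * (1 - w)), squarePoint_mem hub (rotate_mem hwS)⟩ :=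
        Subtype.ext (squarePoint_rotate h hvu w).symm
      rw [this]
      refine he'.apply_eq b hub _ (rotate_mem hwS) ?_
      simp
      linarith
  -- Below the edge the point lies in the square of the reversed dart, with coordinate `1 - w` seen
  -- from `u` and `i w` seen from `v`.
  · have hwS : 1 - w ∈ unitSquare := by
      refine ⟨?_, ?_, ?_, ?_⟩ <;> simp <;> linarith
    have hwS' := rotate_mem hwS
    have hX : (⟨squarePoint σ u v (1 - w), squarePoint_mem hvu.symm hwS⟩ : quadSurface σ) =
        ⟨squarePoint σ v b' (Complex.I * (1 - (1 - w))), squarePoint_mem hvb' hwS'⟩ :=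
      Subtype.ext (squarePoint_rotate h hvu.symm _).symm
    refine ⟨⟨squarePoint σ u v (1 - w), squarePoint_mem hvu.symm hwS⟩, ?_, ?_, ?_⟩
    · rw [hX, he.source_eq, mem_ofPred_eq, hat hvb']
      simp
      linarith
    · rw [hX, he.apply_eq b' hvb' _ hwS' (by simp; linarith), sub_sub_cancel,
        sectorMap_I_mul _ (Or.inl w1)]
      have := hp.modEq b' hvb'.symm
      rw [hb', Equiv.apply_symm_apply, ← hb'] at this
      exact (sectorMap_congr hm this _).symm
    · rw [he'.apply_eq v hvu.symm _ hwS (by simp; linarith), Function.comp_apply,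
        sectorMap_I_mul _ (Or.inl (by simp; linarith))]
      have := hq.modEq b hub.symm
      rw [hb, Equiv.apply_symm_apply, ← hb] at this
      exact sectorMap_congr hm this _

/-- A point of the overlap has positive coordinates at both vertices, so it is not a vertex. It lies
inside a square or on the edge joining `v` and `u`. -/
theorem IsStarChart.preservesOrientation (hvu : v ≠ u) (he : IsStarChart σ m v p e)
    (he' : IsStarChart σ m u q e') (hm : 0 < m) (hp : IsCyclicNumbering (σ v) v m p)
    (hq : IsCyclicNumbering (σ u) u m q) : PreservesOrientation (e.symm.trans e') := by
  have hat : ∀ {u v : V} (_ : u ≠ v) (z : ℂ), (squarePoint σ u v z).1 u = (1 - z.re) * (1 - z.im) :=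
    fun hu z => (squarePoint_fst h hV hu z).1
  refine preservesOrientation_of_hasDerivAt fun w hw => ?_
  rw [OpenPartialHomeomorph.trans_source, OpenPartialHomeomorph.symm_source] at hw
  obtain ⟨hw1, hw2⟩ := hw
  rw [mem_preimage, he'.source_eq] at hw2
  have hw3 := e.map_target hw1
  rw [he.source_eq] at hw3
  rw [← e.right_inv hw1]
  generalize e.symm w = X at hw2 hw3
  obtain ⟨_, s, t, hst, z, hz, rfl⟩ := X
  simp only [mem_ofPred_eq] at hw2 hw3
  obtain ⟨y, hy, w, hwS, hX⟩ := exists_squarePoint_of_pos h hst hz (x := v)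
    (by linarith : (0 : ℝ) < _).ne'
  simp only [hX] at hw2 hw3 ⊢
  rcases (bump_nonneg hwS).eq_or_lt with hb | hb
  · obtain ⟨t, y', hy', ht0, ht1, e1⟩ : ∃ (t : ℝ) (y' : V), v ≠ y' ∧ 0 ≤ t ∧ t ≤ 1 ∧
        squarePoint σ v y w = squarePoint σ v y' t := by
      rw [hat hy] at hw3
      obtain ⟨a1, a2, a3, a4⟩ := hwS
      unfold bump at hb
      have hne : (1 - w.re) * (1 - w.im) ≠ 0 := by linarith
      rcases mul_eq_zero.1 ((mul_eq_zero.1 hb.symm).resolve_right hne) with h0 | h0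
      · refine ⟨w.im, σ v y, (h.apply_ne_self hy.symm).symm, a3, a4, ?_⟩
        rw [squarePoint_ofReal, ← squarePoint_ofReal_mul_I]
        congr 1
        apply Complex.ext <;> simp [h0]
      · refine ⟨w.re, y, hy, a1, a2, ?_⟩
        congr 1
        apply Complex.ext <;> simp [h0]
    simp only [e1] at hw2 hw3 ⊢
    have hu : u = y' := by
      by_contra hne
      rw [squarePoint_ofReal] at hw2
      simp [segPoint, hvu.symm, hne] at hw2
      linarith
    subst hu
    rw [squarePoint_ofReal] at hw2 hw3
    simp [segPoint, hvu, hvu.symm] at hw2 hw3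
    exact he.exists_hasDerivAt_of_segment h hV hvu he' hm hp hq (by simpa using hw2)
      (by simpa using hw3) ⟨by simpa using ht0, by simpa using ht1, by simp, by simp⟩
  · exact he.exists_hasDerivAt_of_interior h hV he' hm hy hwS hb hw3 hw2

end transition

/-! ### The surface is orientable -/

section surface

variable {V : Type*} [DecidableEq V] {σ : V → Equiv.Perm V} (h : IsQuadRotation σ)
  (hV : ∀ u v : V, ∃ w, w ≠ u ∧ w ≠ v)
include h hV

theorem isOrientableSurface_quadSurface [Fintype V] : IsOrientableSurface (quadSurface σ) := by
  have hat : ∀ {u v : V} (_ : u ≠ v) (z : ℂ), (squarePoint σ u v z).1 u = (1 - z.re) * (1 - z.im) :=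
    fun hu z => (squarePoint_fst h hV hu z).1
  have hm : ∀ v : V, 0 < Fintype.card V - 1 := fun v => by
    obtain ⟨w, hw, -⟩ := hV v v
    have := Fintype.one_lt_card_iff.2 ⟨w, v, hw⟩
    omega
  have hp : ∀ v, ∃ p, IsCyclicNumbering (σ v) v (Fintype.card V - 1) p := fun v => by
    obtain ⟨w, hw, -⟩ := hV v v
    exact exists_isCyclicNumbering (h.isCycleOn v) hw
  choose p hp using hp
  have hc : ∀ v, ∃ e : OpenPartialHomeomorph (quadSurface σ) ℂ,
      IsStarChart σ (Fintype.card V - 1) v (p v) e := fun v => by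
    obtain ⟨e, h1, h2⟩ := exists_chart h hV (hm v) (hp v)
    exact ⟨e, h1, h2⟩
  choose e he using hc
  -- The barycentric coordinates at the four corners sum to `1`, so they cannot all be at most `1 /
  -- 5`.
  have hcov : ∀ x : quadSurface σ, ∃ v, x ∈ (e v).source := by
    rintro ⟨_, u, v, huv, z, hz, rfl⟩
    obtain ⟨h1, h2, h3, h4⟩ := squarePoint_fst h hV huv z
    by_contra! hn
    simp only [(he _).source_eq, mem_ofPred_eq, not_lt] at hn
    have n1 := hn u
    have n2 := hn v
    have n3 := hn ((σ v).symm u)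
    have n4 := hn (σ u v)
    rw [h1] at n1
    rw [h2] at n2
    rw [h3] at n3
    rw [h4] at n4
    linarith
  refine ⟨⟨isCompact_iff_compactSpace.1 isCompact_quadSurface, inferInstance, fun x => ?_⟩,
    range e, fun x => ?_, ?_⟩
  · obtain ⟨v, hv⟩ := hcov x
    exact ⟨e v, hv⟩
  · obtain ⟨v, hv⟩ := hcov x
    exact ⟨e v, ⟨v, rfl⟩, hv⟩
  · rintro _ ⟨v, rfl⟩ _ ⟨u, rfl⟩
    by_cases hvu : v = u
    · subst hvu
      refine preservesOrientation_of_hasDerivAt fun w hw => ⟨1, one_ne_zero, ?_⟩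
      refine (hasDerivAt_id w).congr_of_eventuallyEq ?_
      filter_upwards [((e v).symm.trans (e v)).open_source.mem_nhds hw] with z hz
      rw [OpenPartialHomeomorph.trans_source, OpenPartialHomeomorph.symm_source] at hz
      exact (e v).right_inv hz.1
    · exact (he v).preservesOrientation h hV hvu (he u) (hm v) (hp v) (hp u)

end surface

/-! ### The drawing and its faces -/

theorem unitSquare_eq : unitSquare = Icc 0 1 ×ℂ Icc 0 1 := by
  ext z
  simp [unitSquare, Complex.mem_reProdIm, and_assoc]

theorem interior_unitSquare : interior unitSquare = {z ∈ unitSquare | 0 < bump z} := by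
  ext z
  rw [unitSquare_eq, Complex.interior_reProdIm, interior_Icc, ← unitSquare_eq, mem_ofPred_eq,
    Complex.mem_reProdIm]
  constructor
  · rintro ⟨h1, h2⟩
    have : z ∈ unitSquare := ⟨h1.1.le, h1.2.le, h2.1.le, h2.2.le⟩
    exact ⟨this, (bump_pos_iff this).2 ⟨h1.1, h1.2, h2.1, h2.2⟩⟩
  · rintro ⟨h1, h2⟩
    obtain ⟨a, b, c, d⟩ := (bump_pos_iff h1).1 h2
    exact ⟨⟨a, b⟩, c, d⟩

theorem frontier_unitSquare : frontier unitSquare = {z ∈ unitSquare | bump z = 0} := by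
  rw [isCompact_unitSquare.isClosed.frontier_eq, interior_unitSquare]
  ext z
  simp only [mem_sdiff, mem_ofPred_eq, not_and, not_lt]
  exact ⟨fun ⟨h1, h2⟩ => ⟨h1, le_antisymm (h2 h1) (bump_nonneg h1)⟩, fun ⟨h1, h2⟩ =>
    ⟨h1, fun _ => h2.le⟩⟩

theorem convex_unitSquare : Convex ℝ unitSquare := by
  rw [unitSquare_eq]
  exact ((convex_Icc (0 : ℝ) 1).is_linear_preimage Complex.reLm.isLinear).inter
    ((convex_Icc (0 : ℝ) 1).is_linear_preimage Complex.imLm.isLinear)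

theorem half_mem_interior_unitSquare : (⟨1 / 2, 1 / 2⟩ : ℂ) ∈ interior unitSquare := by
  rw [unitSquare_eq, Complex.interior_reProdIm, interior_Icc, Complex.mem_reProdIm]
  norm_num

/-- A square is a disc. -/
theorem exists_homeomorph_unitSquare_disc : ∃ f : ℂ ≃ₜ ℂ,
    f '' {z ∈ unitSquare | 0 < bump z} = Metric.ball 0 1 ∧
    f '' unitSquare = Metric.closedBall 0 1 ∧
    f '' {z ∈ unitSquare | bump z = 0} = Metric.sphere 0 1 := by
  have := exists_homeomorph_image_interior_closure_frontier_eq_unitBall convex_unitSquare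
    ⟨_, half_mem_interior_unitSquare⟩ isCompact_unitSquare.isBounded
  rwa [interior_unitSquare, frontier_unitSquare, isCompact_unitSquare.isClosed.closure_eq] at this

section embedding

variable {V : Type*} [DecidableEq V] {σ : V → Equiv.Perm V}

theorem ofReal_mem_unitSquare {t : ℝ} (ht : t ∈ Icc (0 : ℝ) 1) : (t : ℂ) ∈ unitSquare :=
  ⟨by simpa using ht.1, by simpa using ht.2, by simp, by simp⟩

theorem segPoint_mem {u v : V} (huv : u ≠ v) {t : ℝ} (ht : t ∈ Icc (0 : ℝ) 1) :
    segPoint u v t ∈ quadSurface σ := by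
  rw [← squarePoint_ofReal (σ := σ)]
  exact squarePoint_mem huv (ofReal_mem_unitSquare ht)

theorem continuous_segPoint (u v : V) : Continuous (segPoint u v) := by
  unfold segPoint
  refine Continuous.prodMk (continuous_pi fun x => ?_) continuous_const
  simp only [Pi.add_apply, Pi.single_apply]
  split_ifs <;> fun_prop

/-- The straight drawing of the complete graph in the surface. -/
noncomputable def quadEmbedding (σ : V → Equiv.Perm V) (hV : ∀ u v : V, ∃ w, w ≠ u ∧ w ≠ v) :
    GraphEmbedding (SimpleGraph.completeGraph V) (quadSurface σ) where
  vert v := ⟨(Pi.single v 1, 0), by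
    obtain ⟨w, hw, -⟩ := hV v v
    rw [← segPoint_zero v w]
    exact segPoint_mem hw.symm ⟨le_rfl, zero_le_one⟩⟩
  vert_injective u v e := by
    have := congrFun (congrArg Prod.fst (congrArg Subtype.val e)) u
    by_contra hne
    simp [hne] at this
  arc d :=
    { toFun := fun t => ⟨segPoint d.fst d.snd t, segPoint_mem d.adj.ne t.2⟩
      continuous_toFun :=
        ((continuous_segPoint d.fst d.snd).comp continuous_subtype_val).subtype_mk _
      source' := Subtype.ext (segPoint_zero _ _)
      target' := Subtype.ext (segPoint_one _ _) }
  arc_symm d := Path.ext (funext fun t => Subtype.ext (segPoint_symm d.snd d.fst t))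
  arc_injective d t t' e := by
    have := congrFun (congrArg Prod.fst (congrArg Subtype.val e)) d.snd
    have hne := d.adj.ne
    simpa [segPoint, Pi.single_apply, hne.symm, Subtype.ext_iff] using this
  arc_eq_vert d t v e := by
    have e := congrArg Prod.fst (congrArg Subtype.val e)
    have h1 := congrFun e d.snd
    have hne := d.adj.ne
    simp only [Path.coe_mk', ContinuousMap.coe_mk, segPoint, Pi.add_apply, Pi.single_apply,
      hne.symm, if_true, if_false, zero_add] at h1
    split_ifs at h1
    · exact Or.inr (Subtype.ext h1)
    · exact Or.inl (Subtype.ext h1)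
  arc_eq_arc d d' t t' e := by
    by_contra! hn
    have e := congrArg Subtype.val e
    rcases segPoint_inj d.adj.ne (fun h => hn.2.1 (Subtype.ext h))
      (fun h => hn.2.2 (Subtype.ext h)) d'.adj.ne e with ⟨h1, h2, -⟩ | ⟨h1, h2, -⟩
    · exact hn.1 (by rw [SimpleGraph.dart_edge_eq_iff]; left; ext <;> assumption)
    · exact hn.1 (by rw [SimpleGraph.dart_edge_eq_iff]; right; ext <;> assumption)

variable (h : IsQuadRotation σ) (hV : ∀ u v : V, ∃ w, w ≠ u ∧ w ≠ v)

theorem mem_range_arc (d : (SimpleGraph.completeGraph V).Dart) (X : quadSurface σ) :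
    X ∈ range ((quadEmbedding σ hV).arc d) ↔ ∃ t ∈ Icc (0 : ℝ) 1, segPoint d.fst d.snd t = X.1 := by
  constructor
  · rintro ⟨t, rfl⟩
    exact ⟨t, t.2, rfl⟩
  · rintro ⟨t, ht, e⟩
    exact ⟨⟨t, ht⟩, Subtype.ext e⟩

include h in
theorem faceDarts_ne {u v : V} (huv : u ≠ v) {p : V × V} (hp : p ∈ faceDarts σ u v) : p.1 ≠ p.2 := by
  simp only [faceDarts, Finset.mem_insert, Finset.mem_singleton] at hp
  rcases hp with rfl | rfl | rfl | rfl
  · exact huv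
  · exact (h.inv_apply_ne_self huv).symm
  · exact h.third_ne_fourth huv
  · exact h.apply_ne_self huv.symm

include h in
theorem faceDarts_rotate {u v : V} (huv : u ≠ v) :
    faceDarts σ v ((σ v).symm u) = faceDarts σ u v := by
  have e4 : σ v ((σ v).symm u) = u := Equiv.apply_symm_apply _ _
  ext p
  simp only [faceDarts, h.inv_third huv, e4, Finset.mem_insert, Finset.mem_singleton]
  tauto

include h in
theorem faceDarts_eq_of_mem {u v : V} (huv : u ≠ v) {p : V × V} (hp : p ∈ faceDarts σ u v) :
    faceDarts σ p.1 p.2 = faceDarts σ u v := by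
  have n1 := (h.inv_apply_ne_self huv).symm
  have n2 := h.third_ne_fourth huv
  have e1 := faceDarts_rotate h huv
  have e2 := faceDarts_rotate h n1
  rw [h.inv_third huv] at e2
  have e3 := faceDarts_rotate h n2
  rw [h.inv_fourth huv] at e3
  simp only [faceDarts, Finset.mem_insert, Finset.mem_singleton] at hp
  rcases hp with rfl | rfl | rfl | rfl
  · rfl
  · exact e1
  · exact e2.trans e1
  · exact e3.trans (e2.trans e1)

include h in
/-- The boundary of a square consists of four segments. -/
theorem image_boundary {u v : V} (huv : u ≠ v) (X : (V → ℝ) × (V × V → ℝ)) :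
    (∃ z ∈ unitSquare, bump z = 0 ∧ squarePoint σ u v z = X) ↔
      ∃ p ∈ faceDarts σ u v, ∃ t ∈ Icc (0 : ℝ) 1, segPoint p.1 p.2 t = X := by
  -- The right and upper sides become the lower side after one and two quarter turns.
  have s2 : ∀ t : ℝ, squarePoint σ u v (1 + t * Complex.I) = segPoint v ((σ v).symm u) t := by
    intro t
    rw [← squarePoint_rotate h huv, ← squarePoint_ofReal (σ := σ)]
    congr 1
    linear_combination (-(t : ℂ)) * Complex.I_mul_I
  have s3 : ∀ t : ℝ, squarePoint σ u v (((1 - t : ℝ) : ℂ) + Complex.I) =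
      segPoint ((σ v).symm u) (σ u v) t := by
    intro t
    have h' := squarePoint_rotate h (h.inv_apply_ne_self huv).symm (1 + t * Complex.I)
    rw [h.inv_third huv] at h'
    rw [← squarePoint_rotate h huv, ← squarePoint_ofReal (σ := σ)]
    convert h'.symm using 2
    · push_cast
      linear_combination (-1 : ℂ) * Complex.I_mul_I
    · linear_combination ((t : ℂ)) * Complex.I_mul_I
  constructor
  · rintro ⟨z, ⟨h1, h2, h3, h4⟩, hb, rfl⟩
    simp only [bump, mul_eq_zero, sub_eq_zero] at hb
    simp only [faceDarts, Finset.mem_insert, Finset.mem_singleton]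
    rcases hb with (hb | hb) | hb | hb
    · refine ⟨_, Or.inr (Or.inr (Or.inr rfl)), 1 - z.im, ⟨by linarith, by linarith⟩, ?_⟩
      rw [← segPoint_symm, ← squarePoint_ofReal_mul_I]
      congr 1
      apply Complex.ext <;> simp [hb]
    · refine ⟨_, Or.inl rfl, z.re, ⟨h1, h2⟩, ?_⟩
      rw [← squarePoint_ofReal (σ := σ)]
      congr 1
      apply Complex.ext <;> simp [hb]
    · refine ⟨_, Or.inr (Or.inl rfl), z.im, ⟨h3, h4⟩, ?_⟩
      rw [← s2]
      congr 1
      apply Complex.ext <;> simp [← hb]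
    · refine ⟨_, Or.inr (Or.inr (Or.inl rfl)), 1 - z.re, ⟨by linarith, by linarith⟩, ?_⟩
      rw [← s3]
      congr 1
      apply Complex.ext <;> simp [← hb]
  · rintro ⟨p, hp, t, ⟨h0, h1⟩, rfl⟩
    simp only [faceDarts, Finset.mem_insert, Finset.mem_singleton] at hp
    rcases hp with rfl | rfl | rfl | rfl
    · exact ⟨t, ofReal_mem_unitSquare ⟨h0, h1⟩, by simp [bump], squarePoint_ofReal _ _ _⟩
    · exact ⟨_, ⟨by simp, by simp, by simpa, by simpa⟩, by simp [bump], s2 t⟩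
    · exact ⟨_, ⟨by simpa, by simpa, by simp, by simp⟩, by simp [bump], s3 t⟩
    · refine ⟨((1 - t : ℝ) : ℂ) * Complex.I, ⟨by simp, by simp, by simpa, by simpa⟩,
        by simp [bump], ?_⟩
      rw [squarePoint_ofReal_mul_I, segPoint_symm, sub_sub_cancel]

include h in
theorem mem_support_iff (X : quadSurface σ) :
    X ∈ (quadEmbedding σ hV).support ↔ X.1.2 = 0 := by
  constructor
  · rintro (⟨v, rfl⟩ | hX)
    · rfl
    · obtain ⟨d, hd⟩ := mem_iUnion.1 hX
      obtain ⟨t, -, e⟩ := (mem_range_arc hV d X).1 hd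
      rw [← e]; rfl
  · obtain ⟨_, u, v, huv, z, hz, rfl⟩ := X
    intro h0
    have hb : bump z = 0 := by
      rw [← squarePoint_snd_self (σ := σ) u v z, h0]; rfl
    obtain ⟨p, hp, t, ht, e⟩ := (image_boundary h huv _).1 ⟨z, hz, hb, rfl⟩
    refine Or.inr (mem_iUnion.2 ⟨⟨p, faceDarts_ne h huv hp⟩, ?_⟩)
    exact (mem_range_arc hV _ _).2 ⟨t, ht, e⟩

include h hV in
/-- The open square to the left of a dart, described by its bump function. -/
theorem bump_coord_pos_iff {u v : V} (huv : u ≠ v) (X : quadSurface σ) :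
    0 < X.1.2 (u, v) ↔ ∃ z ∈ unitSquare, 0 < bump z ∧ squarePoint σ u v z = X.1 := by
  constructor
  · obtain ⟨_, s, t, hst, z, hz, rfl⟩ := X
    intro h0
    have hm : (u, v) ∈ faceDarts σ s t := by
      by_contra hn
      simp [squarePoint, hn] at h0
    have hb : 0 < bump z := by simpa [squarePoint, hm] using h0
    have hx : (squarePoint σ s t z).1 u ≠ 0 := by
      obtain ⟨b1, b2, b3, b4⟩ := (bump_pos_iff hz).1 hb
      obtain ⟨e1, e2, e3, e4⟩ := squarePoint_fst h hV hst z
      have c1 := sub_pos.2 b2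
      have c2 := sub_pos.2 b4
      simp only [faceDarts, Finset.mem_insert, Finset.mem_singleton, Prod.mk.injEq] at hm
      rcases hm with hm | hm | hm | hm <;> rw [hm.1]
      · rw [e1]; positivity
      · rw [e2]; positivity
      · rw [e3]; positivity
      · rw [e4]; positivity
    obtain ⟨y, hy, c, d, hc, hS, hcd⟩ := exists_rebase h hst hx
    have hm' : (u, v) ∈ faceDarts σ u y := by
      by_contra hn
      simp only [(hcd z).1] at h0
      simp [squarePoint, hn] at h0
    have : y = v := by
      simp only [faceDarts, Finset.mem_insert, Finset.mem_singleton, Prod.mk.injEq] at hm'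
      rcases hm' with hm | hm | hm | hm
      · exact hm.2.symm
      · exact absurd hm.1 hy
      · exact absurd hm.1.symm (h.inv_apply_ne hV hy)
      · exact absurd hm.1.symm (h.apply_ne_self hy.symm)
    subst this
    exact ⟨_, hS z hz, by rw [(hcd z).2]; exact hb, (hcd z).1.symm⟩
  · rintro ⟨z, hz, hb, e⟩
    rw [← e, squarePoint_snd_self]
    exact hb

include h in
-- Off the drawing some bump coordinate is positive. The open square of the given point and the
-- union of the open squares of all other faces are disjoint open sets covering this complement, and
-- an open square is connected as an image of a convex set.
theorem exists_eq_of_isFace {F : Set (quadSurface σ)} (hF : (quadEmbedding σ hV).IsFace F) :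
    ∃ u v, u ≠ v ∧ F = {X | 0 < X.1.2 (u, v)} := by
  obtain ⟨X, hX, rfl⟩ := hF
  rw [mem_compl_iff, mem_support_iff h] at hX
  obtain ⟨_, u, v, huv, z, hz, rfl⟩ := X
  have hb : 0 < bump z := by
    refine (bump_nonneg hz).lt_of_ne fun hb => hX ?_
    ext p
    simp [squarePoint, ← hb]
  refine ⟨u, v, huv, ?_⟩
  have hpos : ∀ (X : quadSurface σ) p, 0 ≤ X.1.2 p := by
    rintro ⟨_, u, v, huv, z, hz, rfl⟩ p
    rcases squarePoint_snd_eq_or (σ := σ) u v z p with e | e <;> simp only [e]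
    · exact bump_nonneg hz
    · exact le_rfl
  have hXm : (⟨squarePoint σ u v z, squarePoint_mem huv hz⟩ : quadSurface σ) ∈
      {X : quadSurface σ | 0 < X.1.2 (u, v)} := by
    simpa [squarePoint_snd_self] using hb
  have hXc : (⟨squarePoint σ u v z, squarePoint_mem huv hz⟩ : quadSurface σ) ∈
      (quadEmbedding σ hV).supportᶜ := by
    rw [mem_compl_iff, mem_support_iff h]; exact hX
  have hcont : ∀ p, Continuous fun X : quadSurface σ => X.1.2 p := fun p => by fun_prop
  apply Subset.antisymm
  · refine IsPreconnected.subset_left_of_subset_union (v := ⋃ p ∉ faceDarts σ u v, {X | 0 < X.1.2 p})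
      (isOpen_lt continuous_const (hcont _)) (isOpen_biUnion fun p _ => isOpen_lt continuous_const (hcont _))
      ?_ ?_ ⟨_, mem_connectedComponentIn hXc, hXm⟩ isPreconnected_connectedComponentIn
    · rw [Set.disjoint_left]
      intro Y hY hY'
      obtain ⟨z', hz', hb', e⟩ := (bump_coord_pos_iff h hV huv Y).1 hY
      simp only [mem_iUnion, mem_ofPred_eq] at hY'
      obtain ⟨p, hp, hp'⟩ := hY'
      rw [← e] at hp'
      simp [squarePoint, hp] at hp'
    · intro Y hY
      have := connectedComponentIn_subset _ _ hY
      rw [mem_compl_iff, mem_support_iff h] at this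
      obtain ⟨p, hp⟩ := Function.ne_iff.1 this
      have hp := (hpos Y p).lt_of_ne' hp
      by_cases hpf : p ∈ faceDarts σ u v
      · left
        obtain ⟨z', hz', hb', e⟩ := (bump_coord_pos_iff h hV (faceDarts_ne h huv hpf) Y).1 hp
        change 0 < Y.1.2 (u, v)
        rw [← e]
        simpa [squarePoint, faceDarts_eq_of_mem h huv hpf, self_mem_faceDarts] using hb'
      · right
        exact mem_iUnion₂.2 ⟨p, hpf, hp⟩
  · refine IsPreconnected.subset_connectedComponentIn ?_ hXm ?_
    · have : {X : quadSurface σ | 0 < X.1.2 (u, v)} =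
          (fun z : interior unitSquare => (⟨squarePoint σ u v z,
            squarePoint_mem huv (interior_subset z.2)⟩ : quadSurface σ)) '' univ := by
        ext Y
        rw [mem_ofPred_eq, bump_coord_pos_iff h hV huv]
        constructor
        · rintro ⟨z', hz', hb', e⟩
          exact ⟨⟨z', by rw [interior_unitSquare]; exact ⟨hz', hb'⟩⟩, trivial, Subtype.ext e⟩
        · rintro ⟨⟨z', hz''⟩, -, rfl⟩
          have hz' := hz''
          rw [interior_unitSquare] at hz'
          exact ⟨z', hz'.1, hz'.2, rfl⟩
      rw [this]
      have : PreconnectedSpace (interior unitSquare) :=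
        Subtype.preconnectedSpace convex_unitSquare.interior.isPreconnected
      exact isPreconnected_univ.image _ (((continuous_squarePoint σ u v).comp
        continuous_subtype_val).subtype_mk _).continuousOn
    · intro Y hY
      rw [mem_compl_iff, mem_support_iff h]
      intro h0
      simp [h0] at hY

end embedding

/-! ### The embedding is quadrangular -/

section quadrangular

variable {V : Type*} [DecidableEq V] {σ : V → Equiv.Perm V}
  (h : IsQuadRotation σ) (hV : ∀ u v : V, ∃ w, w ≠ u ∧ w ≠ v)
include h

include hV in
-- The closed square is compact and embeds both in the surface and, through a homeomorphism of the
-- plane, onto the closed disc; the same-fibres principle then compares the open parts.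
theorem nonempty_homeomorph_openSquare {u v : V} (huv : u ≠ v) :
    Nonempty ({X : quadSurface σ | 0 < X.1.2 (u, v)} ≃ₜ Metric.ball (0 : ℂ) 1) := by
  obtain ⟨f, hf1, hf2, -⟩ := exists_homeomorph_unitSquare_disc
  have : CompactSpace unitSquare := isCompact_iff_compactSpace.1 isCompact_unitSquare
  have : Nonempty unitSquare := ⟨⟨_, interior_subset half_mem_interior_unitSquare⟩⟩
  let b : unitSquare → quadSurface σ := fun z => ⟨squarePoint σ u v z, squarePoint_mem huv z.2⟩
  have hb : Continuous b :=
    ((continuous_squarePoint σ u v).comp continuous_subtype_val).subtype_mk _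
  have himage : (fun z : unitSquare => f z) '' (b ⁻¹' {X | 0 < X.1.2 (u, v)}) =
      Metric.ball 0 1 := by
    rw [← hf1]
    ext w
    simp [b, squarePoint_snd_self, and_assoc, and_left_comm]
  obtain ⟨e, he1, he2, -⟩ := exists_openPartialHomeomorph_of_same_fibres
    (a := fun z : unitSquare => f z) (b := b) (by fun_prop) hb
    (fun z w => by
      rw [f.injective.eq_iff, ← (squarePoint_injective h hV huv).eq_iff]
      exact Subtype.mk.injEq .. ▸ Iff.rfl)
    (O := {X | 0 < X.1.2 (u, v)}) (isOpen_lt continuous_const (by fun_prop))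
    (by
      intro X hX
      obtain ⟨z, hz, -, e⟩ := (bump_coord_pos_iff h hV huv X).1 hX
      exact ⟨⟨z, hz⟩, Subtype.ext e⟩)
    (by
      rw [himage]
      refine interior_maximal ?_ Metric.isOpen_ball
      rw [← hf1]
      rintro _ ⟨z, hz, rfl⟩
      exact ⟨⟨z, hz.1⟩, rfl⟩)
  rw [himage] at he2
  rw [← he1, ← he2]
  exact ⟨e.toHomeomorphSourceTarget⟩

/-- The boundary walk of the face to the left of a dart. -/
def faceWalk {u v : V} (huv : u ≠ v) : (SimpleGraph.completeGraph V).Walk u u :=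
  .cons (v := v) huv (.cons (v := (σ v).symm u) (h.inv_apply_ne_self huv).symm
    (.cons (v := σ u v) (h.third_ne_fourth huv) (.cons (h.apply_ne_self huv.symm) .nil)))

omit [DecidableEq V] in
include hV in
theorem faceWalk_isCycle {u v : V} (huv : u ≠ v) : (faceWalk h huv).IsCycle := by
  have h1 := h.apply_ne hV huv
  have h2 := h.inv_apply_ne hV huv
  have h3 := h.apply_ne_self huv.symm
  have h4 := h.inv_apply_ne_self huv
  have h5 := h.third_ne_fourth huv
  rw [faceWalk, SimpleGraph.Walk.cons_isCycle_iff]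
  simp [h1.symm, h2, h2.symm, h3, h3.symm, h4.symm, h5, huv, huv.symm]

theorem mem_darts_faceWalk {u v : V} (huv : u ≠ v) (d : (SimpleGraph.completeGraph V).Dart) :
    d ∈ (faceWalk h huv).darts ↔ d.toProd ∈ faceDarts σ u v := by
  simp [faceWalk, faceDarts, SimpleGraph.Dart.ext_iff]

theorem isBoundedBy_faceWalk {u v : V} (huv : u ≠ v) :
    (quadEmbedding σ hV).IsBoundedBy {X | 0 < X.1.2 (u, v)} (faceWalk h huv) := by
  classical
  obtain ⟨f, hf1, hf2, hf3⟩ := exists_homeomorph_unitSquare_disc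
  have hS : ∀ z ∈ Metric.closedBall (0 : ℂ) 1, f.symm z ∈ unitSquare := by
    rw [← hf2]
    rintro _ ⟨z, hz, rfl⟩
    simpa using hz
  -- The value outside the closed disc is only a filler.
  let φ : ℂ → quadSurface σ := fun z =>
    if hz : f.symm z ∈ unitSquare then ⟨squarePoint σ u v (f.symm z), squarePoint_mem huv hz⟩
    else (quadEmbedding σ hV).vert u
  have hφ : ∀ {z : ℂ} (hz : z ∈ unitSquare),
      φ (f z) = ⟨squarePoint σ u v z, squarePoint_mem huv hz⟩ := by
    intro z hz
    simp only [φ, f.symm_apply_apply, hz, dif_pos]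
  refine ⟨faceWalk_isCycle h hV huv, φ, ?_, ?_, ?_, ?_⟩
  · rw [continuousOn_iff_continuous_domRestrict]
    have : (Metric.closedBall (0 : ℂ) 1).domRestrict φ = fun z =>
        ⟨squarePoint σ u v (f.symm z), squarePoint_mem huv (hS z z.2)⟩ := by
      funext z
      exact dif_pos (hS z z.2)
    rw [this]
    exact (((continuous_squarePoint σ u v).comp f.symm.continuous).comp
      continuous_subtype_val).subtype_mk _
  · rw [← hf2]
    rintro _ ⟨z, hz, rfl⟩ _ ⟨w, hw, rfl⟩ e
    rw [hφ hz, hφ hw] at e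
    rw [squarePoint_injective h hV huv (congrArg Subtype.val e)]
  · rw [← hf1]
    ext X
    rw [mem_ofPred_eq, bump_coord_pos_iff h hV huv]
    constructor
    · rintro ⟨_, ⟨z, hz, rfl⟩, rfl⟩
      exact ⟨z, hz.1, hz.2, by rw [hφ hz.1]⟩
    · rintro ⟨z, hz, hb, e⟩
      exact ⟨f z, ⟨z, ⟨hz, hb⟩, rfl⟩, by rw [hφ hz]; exact Subtype.ext e⟩
  · rw [← hf3]
    ext X
    have : X ∈ φ '' (f '' {z ∈ unitSquare | bump z = 0}) ↔
        ∃ z ∈ unitSquare, bump z = 0 ∧ squarePoint σ u v z = X.1 := by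
      constructor
      · rintro ⟨_, ⟨z, hz, rfl⟩, rfl⟩
        exact ⟨z, hz.1, hz.2, by rw [hφ hz.1]⟩
      · rintro ⟨z, hz, hb, e⟩
        exact ⟨f z, ⟨z, ⟨hz, hb⟩, rfl⟩, by rw [hφ hz]; exact Subtype.ext e⟩
    rw [this, image_boundary h huv]
    simp only [mem_iUnion, mem_range_arc]
    constructor
    · rintro ⟨p, hp, t, ht, e⟩
      exact ⟨⟨p, faceDarts_ne h huv hp⟩, (mem_darts_faceWalk h huv _).2 hp, t, ht, e⟩
    · rintro ⟨d, hd, t, ht, e⟩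
      exact ⟨d.toProd, (mem_darts_faceWalk h huv d).1 hd, t, ht, e⟩

/-- A rotation system with quadrangular faces yields a quadrangular embedding. -/
theorem isQuadrangular_quadEmbedding : (quadEmbedding σ hV).IsQuadrangular := by
  refine ⟨fun F hF => ?_, fun F hF => ?_⟩
  · obtain ⟨u, v, huv, rfl⟩ := exists_eq_of_isFace h hV hF
    exact nonempty_homeomorph_openSquare h hV huv
  · obtain ⟨u, v, huv, rfl⟩ := exists_eq_of_isFace h hV hF
    exact ⟨u, faceWalk h huv, rfl, isBoundedBy_faceWalk h hV huv⟩

end quadrangular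

end

/-! ### Rotation systems from lists -/

theorem List.formPerm_apply_of_infix {α : Type*} [DecidableEq α] {l : List α} (hl : l.Nodup)
    {x y : α} (h : [x, y] <:+: l) : l.formPerm x = y := by
  obtain ⟨s, t, rfl⟩ := h
  have := List.formPerm_apply_lt_getElem _ hl s.length (by simp)
  simpa using this

/-- The quadrangles of a rotation system. -/
def IsQuadFace {V : Type*} (σ : V → Equiv.Perm V) (u v w x : V) : Prop :=
  σ v w = u ∧ σ w x = v ∧ σ x u = w ∧ σ u v = x

theorem IsQuadFace.rotate {V : Type*} {σ : V → Equiv.Perm V} {u v w x : V}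
    (h : IsQuadFace σ u v w x) : IsQuadFace σ v w x u := ⟨h.2.1, h.2.2.1, h.2.2.2, h.1⟩

/-- The first and last conditions on a face determine `w` and `x` from the dart, so finding some
quadrangle at each dart is enough. -/
theorem isQuadRotation_of_exists_isQuadFace {V : Type*} {σ : V → Equiv.Perm V}
    (hc : ∀ v, (σ v).IsCycleOn {v}ᶜ) (hf : ∀ u v, u ≠ v → ∃ w x, IsQuadFace σ u v w x) :
    IsQuadRotation σ := by
  refine ⟨hc, fun u v huv => ?_, fun u v huv => ?_⟩ <;>
  · obtain ⟨w, x, h1, h2, h3, h4⟩ := hf u v huv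
    have : (σ v).symm u = w := by rw [Equiv.symm_apply_eq, h1]
    rw [this, h4]
    assumption

theorem IsQuadRotation.permCongr {V W : Type*} {σ : V → Equiv.Perm V} (h : IsQuadRotation σ)
    (e : V ≃ W) : IsQuadRotation fun w => e.permCongr (σ (e.symm w)) := by
  have hs : ∀ (f : Equiv.Perm V) (x : W), (e.permCongr f).symm x = e (f.symm (e.symm x)) :=
    fun _ _ => rfl
  refine ⟨fun w => ⟨?_, fun x hx y hy => ?_⟩, fun u v huv => ?_, fun u v huv => ?_⟩
  · refine Set.BijOn.mk (fun x hx => ?_) (Equiv.injective _).injOn fun x hx => ?_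
    · have := (h.isCycleOn (e.symm w)).apply_mem_iff (x := e.symm x)
      simp only [Set.mem_compl_iff, Set.mem_singleton_iff, e.symm.injective.eq_iff] at this hx ⊢
      rw [Equiv.permCongr_apply, ← Equiv.eq_symm_apply]
      exact this.2 hx
    · have := (h.isCycleOn (e.symm w)).apply_mem_iff (x := (σ (e.symm w)).symm (e.symm x))
      simp only [Set.mem_compl_iff, Set.mem_singleton_iff, e.symm.injective.eq_iff,
        Equiv.apply_symm_apply] at this hx
      exact ⟨e ((σ (e.symm w)).symm (e.symm x)), fun hw => this.1 hx
        ((e.symm_apply_apply _).symm.trans (congrArg e.symm hw)), by simp⟩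
  · obtain ⟨i, hi⟩ := (h.isCycleOn (e.symm w)).2 (x := e.symm x) (by simpa using hx)
      (y := e.symm y) (by simpa using hy)
    refine ⟨i, ?_⟩
    have : (e.permCongr (σ (e.symm w))) ^ i = e.permCongr (σ (e.symm w) ^ i) :=
      (map_zpow e.permCongrHom _ i).symm
    rw [this, Equiv.permCongr_apply, hi, Equiv.apply_symm_apply]
  · have := h.apply_third _ _ (e.symm.injective.ne huv)
    simp only [hs, Equiv.permCongr_apply, Equiv.symm_apply_apply, this, Equiv.apply_symm_apply]
  · have := h.apply_fourth _ _ (e.symm.injective.ne huv)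
    simp only [hs, Equiv.permCongr_apply, Equiv.symm_apply_apply, this]

/-! ### Lists of twins -/

section twins

/-- The list of the twins of a list of classes. -/
def twinList {C : Type*} (l : List C) : List (C × Bool) := l.flatMap fun c => [(c, false), (c, true)]

variable {C : Type*} {l : List C}

theorem mem_twinList {p : C × Bool} : p ∈ twinList l ↔ p.1 ∈ l := by
  obtain ⟨c, s⟩ := p
  cases s <;> simp [twinList]

theorem nodup_twinList (hl : l.Nodup) : (twinList l).Nodup := by
  rw [twinList, List.nodup_flatMap]
  refine ⟨fun c _ => by simp, hl.imp fun hab => ?_⟩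
  simp [List.disjoint_left, hab]

theorem infix_twinList {c : C} (hc : c ∈ l) : [(c, false), (c, true)] <:+: twinList l := by
  obtain ⟨l₁, l₂, rfl⟩ := List.append_of_mem hc
  exact ⟨twinList l₁, twinList l₂, by simp [twinList]⟩

/-- In `a`, twins, `b`, a step between different pairs leaves a twin marked `true` or `a`, and
enters a twin marked `false` or `b`. These are the steps that produce faces; this lemma and the next
three find them from either end. -/
theorem exists_infix_after {c : C} (hc : c ∈ l) (a b : C × Bool) :
    ∃ q, [(c, true), q] <:+: a :: (twinList l ++ [b]) ∧
      (q = b ∨ q.2 = false ∧ q.1 ∈ l) := by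
  obtain ⟨l₁, l₂, rfl⟩ := List.append_of_mem hc
  cases l₂ with
  | nil => exact ⟨b, ⟨a :: (twinList l₁ ++ [(c, false)]), [], by simp [twinList]⟩, Or.inl rfl⟩
  | cons d l₂ =>
    exact ⟨(d, false), ⟨a :: (twinList l₁ ++ [(c, false)]), (d, true) :: (twinList l₂ ++ [b]),
      by simp [twinList]⟩, Or.inr ⟨rfl, by simp⟩⟩

theorem exists_infix_before {c : C} (hc : c ∈ l) (a b : C × Bool) :
    ∃ p, [p, (c, false)] <:+: a :: (twinList l ++ [b]) ∧
      (p = a ∨ p.2 = true ∧ p.1 ∈ l) := by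
  obtain ⟨l₁, l₂, rfl⟩ := List.append_of_mem hc
  rcases List.eq_nil_or_concat l₁ with rfl | ⟨l₁, d, rfl⟩
  · exact ⟨a, ⟨[], (c, true) :: (twinList l₂ ++ [b]), by simp [twinList]⟩, Or.inl rfl⟩
  · exact ⟨(d, true), ⟨a :: (twinList l₁ ++ [(d, false)]), (c, true) :: (twinList l₂ ++ [b]),
      by simp [twinList]⟩, Or.inr ⟨rfl, by simp⟩⟩

theorem exists_infix_first (a b : C × Bool) :
    ∃ q, [a, q] <:+: a :: (twinList l ++ [b]) ∧ (q = b ∨ q.2 = false ∧ q.1 ∈ l) := by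
  cases l with
  | nil => exact ⟨b, ⟨[], [], by simp [twinList]⟩, Or.inl rfl⟩
  | cons d l => exact ⟨(d, false), ⟨[], (d, true) :: (twinList l ++ [b]), by simp [twinList]⟩,
      Or.inr ⟨rfl, by simp⟩⟩

theorem exists_infix_last (a b : C × Bool) :
    ∃ p, [p, b] <:+: a :: (twinList l ++ [b]) ∧ (p = a ∨ p.2 = true ∧ p.1 ∈ l) := by
  rcases List.eq_nil_or_concat l with rfl | ⟨l, d, rfl⟩
  · exact ⟨a, ⟨[], [], by simp [twinList]⟩, Or.inl rfl⟩
  · exact ⟨(d, true), ⟨a :: (twinList l ++ [(d, false)]), [], by simp [twinList]⟩,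
      Or.inr ⟨rfl, by simp⟩⟩

end twins

/-! ### The quadrangular embedding of `K₈` -/

section block

/-- The second corner of the distinguished face at a class of twins of `K₈`. -/
def seamHead : Fin 4 → Fin 4 × Bool :=
  ![(3, true), (2, true), (3, false), (0, true)]

/-- The fourth corner of the distinguished face at a class of twins of `K₈`. -/
def seamLast : Fin 4 → Fin 4 × Bool :=
  ![(1, false), (3, true), (3, true), (1, true)]

/-- The cyclic orders of a quadrangular embedding of `K₈`, without the ends. -/
def blockMid : Fin 4 × Bool → List (Fin 4 × Bool)
  | (0, false) => [(2, false), (2, true), (1, true), (3, false), (0, true)]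
  | (0, true) => [(3, false), (0, false), (1, true), (2, true), (2, false)]
  | (1, false) => [(2, false), (3, false), (0, false), (0, true), (1, true)]
  | (1, true) => [(0, false), (1, false), (2, false), (0, true), (3, false)]
  | (2, false) => [(1, false), (2, true), (1, true), (0, true), (0, false)]
  | (2, true) => [(1, true), (1, false), (0, false), (0, true), (2, false)]
  | (3, false) => [(0, false), (2, true), (2, false), (1, false), (3, true)]
  | (3, true) => [(0, false), (3, false), (2, false), (2, true), (1, false)]

/-- The cyclic orders of a quadrangular embedding of `K₈`. At each class `c` of twins there is a
distinguished face `(c, false)`, `seamHead c`, `(c, true)`, `seamLast c`; the lists at the twins are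
cut open there. -/
def blockList : Fin 4 × Bool → List (Fin 4 × Bool)
  | (c, true) => seamHead c :: (blockMid (c, true) ++ [seamLast c])
  | (c, false) => seamLast c :: (blockMid (c, false) ++ [seamHead c])

theorem nodup_blockList : ∀ x, (blockList x).Nodup := by decide

theorem mem_blockList : ∀ x y, y ∈ blockList x ↔ y ≠ x := by decide

/-- At the remaining corners of a distinguished face the twins are consecutive in the list itself
and not across its cut, so insertions elsewhere do not separate them. -/
theorem infix_blockList_seamHead :
    ∀ d, [(d, true), (d, false)] <:+: blockList (seamHead d) := by decide

theorem infix_blockList_seamLast :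
    ∀ d, [(d, false), (d, true)] <:+: blockList (seamLast d) := by decide

-- In the first case no corner of the face meets a cut, so the face survives the insertions; in the
-- second the dart lies on a distinguished face.
set_option maxRecDepth 10000 in
theorem blockList_faces : ∀ x y, x ≠ y →
    (∃ w z, [w, x] <:+: blockList y ∧ [z, y] <:+: blockList w ∧ [x, w] <:+: blockList z ∧
      [y, z] <:+: blockList x) ∨
    (∃ d, x = (d, false) ∧ y = seamHead d ∨ x = seamHead d ∧ y = (d, true) ∨
      x = (d, true) ∧ y = seamLast d ∨ x = seamLast d ∧ y = (d, false)) := by decide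

end block

/-! ### Joining the blocks -/

section rotation

variable {k : ℕ}

/-- The inclusion of a block of eight vertices. -/
def inBlock (i : Fin k) (x : Fin 4 × Bool) : (Fin k × Fin 4) × Bool := ((i, x.1), x.2)

theorem inBlock_injective (i : Fin k) : Function.Injective (inBlock i) := by
  rintro ⟨a, b⟩ ⟨c, d⟩ e
  simpa [inBlock] using e

/-- The classes of twins outside of a block. -/
noncomputable def outerClasses (i : Fin k) : List (Fin k × Fin 4) :=
  (Finset.univ.filter fun c : Fin k × Fin 4 => c.1 ≠ i).toList

theorem mem_outerClasses {i : Fin k} {c : Fin k × Fin 4} : c ∈ outerClasses i ↔ c.1 ≠ i := by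
  simp [outerClasses]

/-- The cyclic order at a vertex: first its own block, then the others, in an order which is
reversed for the twin. -/
noncomputable def rotationList (v : (Fin k × Fin 4) × Bool) : List ((Fin k × Fin 4) × Bool) :=
  (blockList (v.1.2, v.2)).map (inBlock v.1.1) ++
    if v.2 then twinList (outerClasses v.1.1) else (twinList (outerClasses v.1.1)).reverse

theorem mem_rotationList {v w : (Fin k × Fin 4) × Bool} : w ∈ rotationList v ↔ w ≠ v := by
  obtain ⟨⟨i, c⟩, s⟩ := v
  obtain ⟨⟨j, d⟩, t⟩ := w
  have h1 : ((j, d), t) ∈ (blockList (c, s)).map (inBlock i) ↔ i = j ∧ (d, t) ≠ (c, s) := by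
    rw [List.mem_map]
    constructor
    · rintro ⟨x, hx, e⟩
      simp only [inBlock, Prod.mk.injEq] at e
      obtain ⟨⟨rfl, rfl⟩, rfl⟩ := e
      exact ⟨rfl, (mem_blockList _ _).1 hx⟩
    · rintro ⟨rfl, h⟩
      exact ⟨(d, t), (mem_blockList _ _).2 h, rfl⟩
  rw [rotationList, List.mem_append, h1]
  have h2 : ((j, d), t) ∈ (if s then twinList (outerClasses i)
      else (twinList (outerClasses i)).reverse) ↔ j ≠ i := by
    split_ifs
    · rw [mem_twinList, mem_outerClasses]
    · rw [List.mem_reverse, mem_twinList, mem_outerClasses]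
  rw [h2]
  simp only [ne_eq, Prod.mk.injEq]
  by_cases hij : j = i
  · simp [hij]
  · simp [hij]

theorem nodup_rotationList (v : (Fin k × Fin 4) × Bool) : (rotationList v).Nodup := by
  have hT : (twinList (outerClasses v.1.1)).Nodup := nodup_twinList (Finset.nodup_toList _)
  have hmem : ∀ w ∈ (if v.2 then twinList (outerClasses v.1.1)
      else (twinList (outerClasses v.1.1)).reverse), w.1.1 ≠ v.1.1 := by
    intro w hw
    split_ifs at hw
    · exact mem_outerClasses.1 (mem_twinList.1 hw)
    · exact mem_outerClasses.1 (mem_twinList.1 (List.mem_reverse.1 hw))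
  refine List.Nodup.append ((nodup_blockList _).map (inBlock_injective _)) ?_ ?_
  · split_ifs
    · exact hT
    · exact List.nodup_reverse.2 hT
  · intro w hw hw'
    obtain ⟨x, -, rfl⟩ := List.mem_map.1 hw
    exact hmem _ hw' rfl

/-- The rotation system. -/
noncomputable def blockRotation (v : (Fin k × Fin 4) × Bool) :
    Equiv.Perm ((Fin k × Fin 4) × Bool) := (rotationList v).formPerm

theorem blockRotation_isCycleOn (v : (Fin k × Fin 4) × Bool) :
    (blockRotation v).IsCycleOn {v}ᶜ := by
  have : ({v}ᶜ : Set ((Fin k × Fin 4) × Bool)) = {w | w ∈ rotationList v} := by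
    ext w
    simp [mem_rotationList]
  rw [this]
  exact (nodup_rotationList v).isCycleOn_formPerm

theorem blockRotation_inBlock {i : Fin k} {v x y : Fin 4 × Bool} (h : [x, y] <:+: blockList v) :
    blockRotation (inBlock i v) (inBlock i x) = inBlock i y :=
  List.formPerm_apply_of_infix (nodup_rotationList _)
    (List.infix_append_of_infix_left (h.map (inBlock i)))

theorem blockRotation_twin_of_true {v : (Fin k × Fin 4) × Bool} {c : Fin k × Fin 4}
    (hc : c.1 ≠ v.1.1) (hv : v.2 = true) : blockRotation v (c, false) = (c, true) := by
  refine List.formPerm_apply_of_infix (nodup_rotationList _) (List.infix_append_of_infix_right ?_)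
  rw [if_pos hv]
  exact infix_twinList (mem_outerClasses.2 hc)

theorem blockRotation_twin_of_false {v : (Fin k × Fin 4) × Bool} {c : Fin k × Fin 4}
    (hc : c.1 ≠ v.1.1) (hv : v.2 = false) : blockRotation v (c, true) = (c, false) := by
  refine List.formPerm_apply_of_infix (nodup_rotationList _) (List.infix_append_of_infix_right ?_)
  rw [if_neg (by simp [hv])]
  exact List.reverse_infix.1 (by simpa using infix_twinList (mem_outerClasses.2 hc))

/-- The neighbours of the twins of a class outside their block, with the ends of the block. -/
noncomputable def seamList (c : Fin k × Fin 4) : List ((Fin k × Fin 4) × Bool) :=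
  inBlock c.1 (seamLast c.2) :: (twinList (outerClasses c.1) ++ [inBlock c.1 (seamHead c.2)])

theorem blockRotation_seam_true {c : Fin k × Fin 4} {p q : (Fin k × Fin 4) × Bool}
    (h : [p, q] <:+: seamList c) : blockRotation (c, true) p = q := by
  -- Read cyclically from `seamLast`, the order passes through the inserted twins and returns to the
  -- block at `seamHead`; `seamList` is this stretch.
  have hrot : rotationList (c, true) ~r
      seamList c ++ (blockMid (c.2, true)).map (inBlock c.1) := by
    have : rotationList (c, true) =
        (inBlock c.1 (seamHead c.2) :: (blockMid (c.2, true)).map (inBlock c.1)) ++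
          (inBlock c.1 (seamLast c.2) :: twinList (outerClasses c.1)) := by
      simp [rotationList, blockList]
    rw [this]
    refine List.isRotated_append.trans ?_
    simp [seamList, List.IsRotated.refl]
  rw [blockRotation, List.formPerm_eq_of_isRotated (nodup_rotationList _) hrot]
  exact List.formPerm_apply_of_infix (hrot.nodup_iff.1 (nodup_rotationList _))
    (List.infix_append_of_infix_left h)

theorem blockRotation_seam_false {c : Fin k × Fin 4} {p q : (Fin k × Fin 4) × Bool}
    (h : [p, q] <:+: seamList c) : blockRotation (c, false) q = p := by
  have hrot : rotationList (c, false) ~r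
      (seamList c).reverse ++ (blockMid (c.2, false)).map (inBlock c.1) := by
    have : rotationList (c, false) =
        (inBlock c.1 (seamLast c.2) :: (blockMid (c.2, false)).map (inBlock c.1)) ++
          (inBlock c.1 (seamHead c.2) :: (twinList (outerClasses c.1)).reverse) := by
      simp [rotationList, blockList]
    rw [this]
    refine List.isRotated_append.trans ?_
    simp [seamList, List.IsRotated.refl]
  rw [blockRotation, List.formPerm_eq_of_isRotated (nodup_rotationList _) hrot]
  exact List.formPerm_apply_of_infix (hrot.nodup_iff.1 (nodup_rotationList _))
    (List.infix_append_of_infix_left (by simpa using List.reverse_infix.2 h))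

/-- The faces around a pair of twins. -/
theorem isQuadFace_seam {c : Fin k × Fin 4} {p q : (Fin k × Fin 4) × Bool}
    (h : [p, q] <:+: seamList c)
    (hp : p = inBlock c.1 (seamLast c.2) ∨ p.2 = true ∧ p.1 ∈ outerClasses c.1)
    (hq : q = inBlock c.1 (seamHead c.2) ∨ q.2 = false ∧ q.1 ∈ outerClasses c.1) :
    IsQuadFace blockRotation (c, true) p (c, false) q := by
  refine ⟨?_, blockRotation_seam_false h, ?_, blockRotation_seam_true h⟩
  · rcases hp with rfl | ⟨h1, h2⟩
    · exact blockRotation_inBlock (infix_blockList_seamLast c.2)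
    · exact blockRotation_twin_of_true (mem_outerClasses.1 h2).symm h1
  · rcases hq with rfl | ⟨h1, h2⟩
    · exact blockRotation_inBlock (infix_blockList_seamHead c.2)
    · exact blockRotation_twin_of_false (mem_outerClasses.1 h2).symm h1

theorem exists_isQuadFace_seam_true {c d : Fin k × Fin 4} (h : c.1 ≠ d.1) :
    ∃ q, IsQuadFace blockRotation (c, true) (d, true) (c, false) q := by
  obtain ⟨q, h1, h2⟩ := exists_infix_after (mem_outerClasses.2 h.symm)
    (inBlock c.1 (seamLast c.2)) (inBlock c.1 (seamHead c.2))
  exact ⟨q, isQuadFace_seam h1 (Or.inr ⟨rfl, mem_outerClasses.2 h.symm⟩) h2⟩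

theorem exists_isQuadFace_seam_false {c d : Fin k × Fin 4} (h : c.1 ≠ d.1) :
    ∃ p, IsQuadFace blockRotation (c, true) p (c, false) (d, false) := by
  obtain ⟨p, h1, h2⟩ := exists_infix_before (mem_outerClasses.2 h.symm)
    (inBlock c.1 (seamLast c.2)) (inBlock c.1 (seamHead c.2))
  exact ⟨p, isQuadFace_seam h1 h2 (Or.inr ⟨rfl, mem_outerClasses.2 h.symm⟩)⟩

theorem isQuadRotation_blockRotation :
    IsQuadRotation (blockRotation : (Fin k × Fin 4) × Bool → _) := by
  refine isQuadRotation_of_exists_isQuadFace blockRotation_isCycleOn ?_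
  rintro ⟨⟨i, c⟩, s⟩ ⟨⟨j, d⟩, t⟩ huv
  by_cases hij : i = j
  · subst hij
    have hne : (c, s) ≠ (d, t) := fun e => by
      simp only [Prod.mk.injEq] at e
      exact huv (by rw [e.1, e.2])
    -- The first and last new faces in the gap take over the darts of the distinguished face. With a
    -- single block nothing is inserted, and both are the distinguished face itself.
    have hface : ∀ e : Fin 4,
        (∃ q, IsQuadFace blockRotation ((i, e), true) (inBlock i (seamLast e)) ((i, e), false) q) ∧
        ∃ p, IsQuadFace blockRotation ((i, e), true) p ((i, e), false) (inBlock i (seamHead e)) := by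
      intro e
      obtain ⟨q, h1, h2⟩ := exists_infix_first (l := outerClasses i)
        (inBlock i (seamLast e)) (inBlock i (seamHead e))
      obtain ⟨p, h3, h4⟩ := exists_infix_last (l := outerClasses i)
        (inBlock i (seamLast e)) (inBlock i (seamHead e))
      exact ⟨⟨q, isQuadFace_seam (c := (i, e)) h1 (Or.inl rfl) h2⟩,
        p, isQuadFace_seam (c := (i, e)) h3 h4 (Or.inl rfl)⟩
    change ∃ w x, IsQuadFace blockRotation (inBlock i (c, s)) (inBlock i (d, t)) w x
    rcases blockList_faces (c, s) (d, t) hne with ⟨w, z, h1, h2, h3, h4⟩ | ⟨e, he⟩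
    · exact ⟨inBlock i w, inBlock i z, blockRotation_inBlock h1, blockRotation_inBlock h2,
        blockRotation_inBlock h3, blockRotation_inBlock h4⟩
    · obtain ⟨⟨q, hq⟩, p, hp⟩ := hface e
      rcases he with ⟨h1, h2⟩ | ⟨h1, h2⟩ | ⟨h1, h2⟩ | ⟨h1, h2⟩ <;> rw [h1, h2]
      · exact ⟨_, _, hp.rotate.rotate⟩
      · exact ⟨_, _, hp.rotate.rotate.rotate⟩
      · exact ⟨_, _, hq⟩
      · exact ⟨_, _, hq.rotate⟩
  -- Between blocks, the twins serving as opposite corners are those of the source if the two marks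
  -- agree, and those of the target otherwise.
  · cases s <;> cases t
    · obtain ⟨p, hp⟩ := exists_isQuadFace_seam_false (c := (i, c)) (d := (j, d)) hij
      exact ⟨_, _, hp.rotate.rotate⟩
    · obtain ⟨p, hp⟩ := exists_isQuadFace_seam_false (c := (j, d)) (d := (i, c)) (Ne.symm hij)
      exact ⟨_, _, hp.rotate.rotate.rotate⟩
    · obtain ⟨q, hq⟩ := exists_isQuadFace_seam_true (c := (j, d)) (d := (i, c)) (Ne.symm hij)
      exact ⟨_, _, hq.rotate⟩
    · obtain ⟨q, hq⟩ := exists_isQuadFace_seam_true (c := (i, c)) (d := (j, d)) hij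
      exact ⟨_, _, hq⟩

end rotation

theorem theorem1p3 (n : ℕ) (hpos : 0 < n) (hn : n ≡ 0 [MOD 8]) :
    ∃ (S : Type) (_ : TopologicalSpace S), IsOrientableSurface S ∧
      ∃ Φ : GraphEmbedding (SimpleGraph.completeGraph (Fin n)) S, Φ.IsQuadrangular := by
  obtain ⟨k, rfl⟩ := (Nat.modEq_zero_iff_dvd).1 hn
  have hcard : Fintype.card ((Fin k × Fin 4) × Bool) = 8 * k := by
    simp [Fintype.card_prod]; ring
  have h := (isQuadRotation_blockRotation (k := k)).permCongr (Fintype.equivFinOfCardEq hcard)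
  -- Positivity of `n` enters here: there are at least eight vertices.
  have hV : ∀ u v : Fin (8 * k), ∃ w, w ≠ u ∧ w ≠ v := by
    intro u v
    have : ({u, v} : Finset (Fin (8 * k))).card < Fintype.card (Fin (8 * k)) := by
      rw [Fintype.card_fin]
      exact (Finset.card_le_two).trans_lt (by omega)
    obtain ⟨w, hw⟩ := Finset.exists_mem_notMem_of_card_lt_card
      (s := {u, v}) (t := Finset.univ) (by simpa using this)
    simp only [Finset.mem_insert, Finset.mem_singleton, not_or] at hw
    exact ⟨w, hw.2⟩
  exact ⟨_, inferInstance, isOrientableSurface_quadSurface h hV, _,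
    isQuadrangular_quadEmbedding h hV⟩
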